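/- **Setting.** Let $\hbar,c,\kappa,l,\nu>0$ and $q,\lambda\neq0$ be real constants, and write ${\bf p}$ and ${\bf k}$ in $\mathbb R^3$ for the wave vectors of the photon field and of the electron field. Let $\varepsilon^{(H)},\varepsilon^{(V)}:\mathbb R^3\to\mathbb R^3$ be measurable polarization vectors such that for every ${\bf p}\ne0$ the vectors $\varepsilon^{(H)}({\bf p}),\varepsilon^{(V)}({\bf p})$ are orthonormal and orthogonal to ${\bf p}$. A wave function $\psi$ assigns to each pair $({\bf p},{\bf k})$ a vector $\psi_{{\bf p},{\bf k}}$ in the tensor product of the Fock space of two photon modes (basis $|m,n\rangle$, $m,n\ge0$; annihilation operators $a_H,a_V$) and the 16-dimensional Fock space of four fermionic modes (basis $|S\rangle$, $S\subset\{1,2,3,4\}$; annihilation operators $\phi_1,\dots,\phi_4$; modes 1, 2 are the electron with spin up and down, modes 3, 4 the positron). Put $\omega({\bf k})=c\sqrt{\kappa^2+|{\bf k}|^2}$ and $$H^{ph}=\hbar c|{\bf p}|\,(a_H^\dagger a_H+a_V^\dagger a_V),\qquad H^{el}=\hbar\omega({\bf k})\sum_{s=1}^4\phi_s^\dagger\phi_s,$$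 $$A_\alpha({\bf x})=\tfrac\lambda2\sum_{j=H,V}\varepsilon^{(j)}_\alpha({\bf p})\left[e^{i{\bf p}\cdot{\bf x}}a_j+e^{-i{\bf p}\cdot{\bf x}}a_j^\dagger\right],\qquad \alpha=1,2,3.$$ Let $u^{(1)},u^{(2)}$ (electron) and $v^{(3)},v^{(4)}$ (positron) be the standard free Dirac spinors in the Dirac representation with rest wave number $\kappa$, normalized to $u^\dagger u=v^\dagger v=\nu$. Put $$\hat\psi_{r,{\bf k}}({\bf x})=\sum_{s=1,2}u_r^{(s)}({\bf k})e^{i{\bf k}\cdot{\bf x}}\phi_s+\sum_{s=3,4}v_r^{(s)}({\bf k})e^{-i{\bf k}\cdot{\bf x}}\phi_s^\dagger ,\qquad \hat\psi^{a}=\hat\psi^\dagger\gamma^0,$$ $$J^\alpha_{{\bf k},{\bf k}'}({\bf x})=\tfrac12\sum_{r,r'}\gamma^\alpha_{r,r'}\hat\psi^{a}_{r,{\bf k}}({\bf x})\hat\psi_{r',{\bf k}'}({\bf x})-\tfrac12\sum_{r,r'}\gamma^\alpha_{r',r}\hat\psi_{r,{\bf k}}({\bf x})\hat\psi^{a}_{r',{\bf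 k}'}({\bf x}).$$ The expected photon energy and interaction energy are $$\langle H^{ph}\rangle=l^6\int d{\bf p}\int d{\bf k}\,\langle\psi_{{\bf p},{\bf k}}|H^{ph}\psi_{{\bf p},{\bf k}}\rangle,$$ $$\langle H^{I}\rangle=l^6\int d{\bf p}\int d{\bf x}\left[\frac{qc}{(2\pi)^3}\int d{\bf k}\int d{\bf k}'\,\Big\langle\psi_{{\bf p},{\bf k}}\Big|\sum_{\alpha=1}^3A_\alpha({\bf x})J^\alpha_{{\bf k},{\bf k}'}({\bf x})\,\psi_{{\bf p},{\bf k}'}\Big\rangle\right].$$ Given a function $\rho^{el}\ge0$ on $\mathbb R^3$, a trial state is a wave function $$\psi_{{\bf p},{\bf k}}=\sum_{m,n\ge0}\tau_{m,n}({\bf p},{\bf k})\sqrt{\frac{\rho({\bf p})\rho^{el}({\bf k})}{m!\,n!\,Z({\bf k})}}\;|m,n\rangle\otimes|\{1\}\rangle+\sqrt{1-\rho({\bf p})\rho^{el}({\bf k})}\;|0,0\rangle\otimes|\emptyset\rangle$$ with $\tau_{m,n}$ measurable with values in $\{0,1\}$, with $\sum_{m,n}\tau_{m,n}({\bf p},{\bf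 k})/(m!\,n!)=Z({\bf k})>0$ for all ${\bf p},{\bf k}$ (so that the sum does not depend on ${\bf p}$), and with $\rho\ge0$ measurable, $l^3\int\rho\,d{\bf p}=1$, and $\rho({\bf p})\rho^{el}({\bf k})\le1$ for all ${\bf p},{\bf k}$. **Theorem.** Let $\sigma>0$ and $\delta>0$. There is $r_0>0$ such that for every $0<\rho^{el}(0)\le r_0$, with $\rho^{el}({\bf k})=\rho^{el}(0)\exp(-|{\bf k}|^2/2\sigma^2)$, there exists a trial state $\psi$ with low-momentum photons, $\rho({\bf p})=0$ for $|{\bf p}|>\delta$, for which 1. the integrals defining $\langle H^{ph}\rangle$ and $\langle H^I\rangle$ converge absolutely (those over $({\bf p},{\bf k})$, over $({\bf k},{\bf k}')$ for each ${\bf p},{\bf x}$, and, for the function in square brackets, over $({\bf p},{\bf x})$), and the number $\langle H^{ph}\rangle+\langle H^{I}\rangle$ is real and satisfies $$\langle H^{ph}\rangle+\langle H^{I}\rangle<0;$$ 2. for every ${\bf k}$, the integral below converges absolutely and $$l^3\int d{\bf p}\,\langle\psi_{{\bf p},{\bf k}}|H^{el}\psi_{{\bf p},{\bf k}}\rangle=\rho^{el}({\bf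 k})\,\hbar\omega({\bf k}).$$ -/

import Mathlib

open MeasureTheory

noncomputable section

namespace RQED

/-- Three-dimensional Euclidean space (wave vectors and positions). -/
abbrev E3 := EuclideanSpace ℝ (Fin 3)

/-- The constants of the model: `hbar`, the speed of light `c`, the electron rest wave number
`kappa`, the charge `q`, the coupling constant `lam` of the vector potential, the unit of
length `ell`, and the value `nu` of the (momentum independent) squared norm of the Dirac
spinors, i.e. the normalization convention `u† u = v† v = nu`. -/
structure Constants where
  hbar : ℝ
  c : ℝ
  kappa : ℝ
  q : ℝ
  lam : ℝ
  ell : ℝ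
  nu : ℝ
  hbar_pos : 0 < hbar
  c_pos : 0 < c
  kappa_pos : 0 < kappa
  q_ne : q ≠ 0
  lam_ne : lam ≠ 0
  ell_pos : 0 < ell
  nu_pos : 0 < nu

/-- Linear polarization vectors: for every wave vector `p ≠ 0` the two real vectors `H p` and
`V p` are orthonormal and transverse to `p`. -/
structure Polarization where
  H : E3 → E3
  V : E3 → E3
  measurable_H : Measurable H
  measurable_V : Measurable V
  norm_H : ∀ p, p ≠ 0 → ‖H p‖ = 1
  norm_V : ∀ p, p ≠ 0 → ‖V p‖ = 1
  inner_H_V : ∀ p, p ≠ 0 → inner ℝ (H p) (V p) = 0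
  inner_H : ∀ p, p ≠ 0 → inner ℝ (H p) p = 0
  inner_V : ∀ p, p ≠ 0 → inner ℝ (V p) p = 0

/-- A vector given by its coefficients in the number basis `|m,n⟩ × |S⟩`: `m` horizontally and
`n` vertically polarized photons, and a set `S` of occupied fermionic modes. The modes `0`, `1`
are the electron with spin up and down, the modes `2`, `3` are the positron. -/
abbrev FockVec := ℕ × ℕ → Finset (Fin 4) → ℂ

/-- Operators on the 16-dimensional fermionic Fock space. -/
abbrev ElOp := Matrix (Finset (Fin 4)) (Finset (Fin 4)) ℂ

/-- In the reducible representation a wave function assigns a Fock vector to every photon wave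
vector (first argument) and every electron wave vector (second argument). -/
abbrev WaveFunction := E3 → E3 → FockVec

/-- The inner product of two Fock vectors. -/
def braket (f g : FockVec) : ℂ :=
  ∑' mn : ℕ × ℕ, ∑ S : Finset (Fin 4), starRingEnd ℂ (f mn S) * g mn S

/-- The action of an operator on the fermionic Fock space. -/
def applyEl (T : ElOp) (f : FockVec) : FockVec := fun mn => T.mulVec (f mn)

/-- Annihilation of a horizontally polarized photon. -/
def annH (f : FockVec) : FockVec :=
  fun mn S => (Real.sqrt (mn.1 + 1) : ℂ) * f (mn.1 + 1, mn.2) S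

/-- Creation of a horizontally polarized photon. -/
def creH (f : FockVec) : FockVec :=
  fun mn S => (Real.sqrt mn.1 : ℂ) * f (mn.1 - 1, mn.2) S

/-- Annihilation of a vertically polarized photon. -/
def annV (f : FockVec) : FockVec :=
  fun mn S => (Real.sqrt (mn.2 + 1) : ℂ) * f (mn.1, mn.2 + 1) S

/-- Creation of a vertically polarized photon. -/
def creV (f : FockVec) : FockVec :=
  fun mn S => (Real.sqrt mn.2 : ℂ) * f (mn.1, mn.2 - 1) S

/-- The fermionic annihilation operator `φ⁺` of mode `s`. -/
def annEl (s : Fin 4) : ElOp :=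
  fun S T => if s ∉ S ∧ T = insert s S then (-1) ^ (S.filter (· < s)).card else 0

/-- The fermionic creation operator `φ⁻` of mode `s`. -/
def creEl (s : Fin 4) : ElOp := (annEl s).conjTranspose

/-- The Dirac matrix `γ⁰`. -/
def gamma0 : Matrix (Fin 4) (Fin 4) ℂ :=
  !![1, 0, 0, 0; 0, 1, 0, 0; 0, 0, -1, 0; 0, 0, 0, -1]

/-- The Dirac matrices `γ¹`, `γ²`, `γ³` (Dirac representation). -/
def gammaSp : Fin 3 → Matrix (Fin 4) (Fin 4) ℂ :=
  ![!![0, 0, 0, 1; 0, 0, 1, 0; 0, -1, 0, 0; -1, 0, 0, 0],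
    !![0, 0, 0, -Complex.I; 0, 0, Complex.I, 0; 0, Complex.I, 0, 0; -Complex.I, 0, 0, 0],
    !![0, 0, 1, 0; 0, 0, 0, -1; -1, 0, 0, 0; 0, 1, 0, 0]]

/-- The plane wave `exp (i k·x)`. -/
def wave (k x : E3) : ℂ := Complex.exp (Complex.I * (inner ℝ k x : ℝ))

namespace Constants

/-- The dispersion relation `ω(k) = c √(κ² + |k|²)` of the electron field. -/
def omega (C : Constants) (k : E3) : ℝ := C.c * Real.sqrt (C.kappa ^ 2 + ‖k‖ ^ 2)

/-- The positive frequency (`s = 0, 1`) and negative frequency (`s = 2, 3`) Dirac spinors: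
the columns are `u⁽¹⁾, u⁽²⁾, v⁽³⁾, v⁽⁴⁾`. -/
def spinor (C : Constants) (k : E3) (s : Fin 4) : Fin 4 → ℂ :=
  let b : ℂ := ((C.c / (C.omega k + C.c * C.kappa) : ℝ) : ℂ)
  let k₁ : ℂ := (k 0 : ℂ)
  let k₂ : ℂ := (k 1 : ℂ)
  let k₃ : ℂ := (k 2 : ℂ)
  let N : ℂ := (Real.sqrt (C.nu * (C.omega k + C.c * C.kappa) / (2 * C.omega k)) : ℂ)
  N • (![![1, 0, b * k₃, b * (k₁ + Complex.I * k₂)],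
         ![0, 1, b * (k₁ - Complex.I * k₂), -(b * k₃)],
         ![b * k₃, b * (k₁ + Complex.I * k₂), 1, 0],
         ![b * (k₁ - Complex.I * k₂), -(b * k₃), 0, 1]] s)

/-- The component `r` of the Dirac field operator with wave vector `k` at position `x` and
time zero. -/
def dirac (C : Constants) (r : Fin 4) (k x : E3) : ElOp :=
  (∑ s ∈ ({0, 1} : Finset (Fin 4)), (C.spinor k s r * wave k x) • annEl s)
    + ∑ s ∈ ({2, 3} : Finset (Fin 4)), (C.spinor k s r * wave (-k) x) • creEl s

/-- The component `r` of the Dirac adjoint `ψ† γ⁰` of the field operator. -/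
def diracAdj (C : Constants) (r : Fin 4) (k x : E3) : ElOp :=
  ∑ t : Fin 4, gamma0 t r • (C.dirac t k x).conjTranspose

/-- The spatial current kernels `J^α_{k,k'}(x)` at time zero. -/
def current (C : Constants) (α : Fin 3) (k k' x : E3) : ElOp :=
  (1 / 2 : ℂ) • (∑ r : Fin 4, ∑ r' : Fin 4,
      gammaSp α r r' • (C.diracAdj r k x * C.dirac r' k' x))
    - (1 / 2 : ℂ) • (∑ r : Fin 4, ∑ r' : Fin 4,
      gammaSp α r' r • (C.dirac r k x * C.diracAdj r' k' x))

/-- The vector potential operators `A_α(x)` at time zero, at photon wave vector `p`. -/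
def potential (C : Constants) (P : Polarization) (α : Fin 3) (p x : E3) (f : FockVec) :
    FockVec :=
  ((C.lam / 2 * P.H p α : ℝ) : ℂ) • (wave p x • annH f + wave (-p) x • creH f)
    + ((C.lam / 2 * P.V p α : ℝ) : ℂ) • (wave p x • annV f + wave (-p) x • creV f)

/-- The Hamiltonian of the photon field at wave vector `p`. -/
def photonHamiltonian (C : Constants) (p : E3) (f : FockVec) : FockVec :=
  ((C.hbar * C.c * ‖p‖ : ℝ) : ℂ) • (creH (annH f) + creV (annV f))

/-- The Hamiltonian of the electron field at wave vector `k`. -/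
def electronHamiltonian (C : Constants) (k : E3) (f : FockVec) : FockVec :=
  applyEl (((C.hbar * C.omega k : ℝ) : ℂ) • ∑ s : Fin 4, creEl s * annEl s) f

/-- `⟨ψ|H^ph ψ⟩` at photon wave vector `p` and electron wave vector `k`. -/
def photonEnergyDensity (C : Constants) (ψ : WaveFunction) (p k : E3) : ℂ :=
  braket (ψ p k) (C.photonHamiltonian p (ψ p k))

/-- `⟨ψ|H^el ψ⟩` at photon wave vector `p` and electron wave vector `k`. -/
def electronEnergyDensity (C : Constants) (ψ : WaveFunction) (p k : E3) : ℂ :=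
  braket (ψ p k) (C.electronHamiltonian k (ψ p k))

/-- The kernel `⟨ψ_{p,k}| ∑_α A_α(x) J^α_{k,k'}(x) ψ_{p,k'}⟩` at time zero. -/
def interactionKernel (C : Constants) (P : Polarization) (ψ : WaveFunction)
    (p x k k' : E3) : ℂ :=
  braket (ψ p k) (∑ α : Fin 3, C.potential P α p x (applyEl (C.current α k k' x) (ψ p k')))

/-- The expectation of `∑_α A_α(x) j^α(x)` (time zero, photon wave vector `p`) as a function of
the position `x`. -/
def interactionDensity (C : Constants) (P : Polarization) (ψ : WaveFunction) (p x : E3) : ℂ :=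
  ((C.q * C.c / (2 * Real.pi) ^ 3 : ℝ) : ℂ) *
    ∫ k : E3, ∫ k' : E3, C.interactionKernel P ψ p x k k'

/-- The expectation `⟨H^ph⟩` of the photon energy. -/
def photonEnergy (C : Constants) (ψ : WaveFunction) : ℂ :=
  ((C.ell ^ 6 : ℝ) : ℂ) * ∫ p : E3, ∫ k : E3, C.photonEnergyDensity ψ p k

/-- The expectation `⟨H^I⟩` of the interaction energy `H^I = ∫ dx ∑_α A_α(x,0) j^α(x,0)`. The
space integral is taken after the integrals over the electron wave vectors. -/
def interactionEnergy (C : Constants) (P : Polarization) (ψ : WaveFunction) : ℂ :=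
  ((C.ell ^ 6 : ℝ) : ℂ) * ∫ p : E3, ∫ x : E3, C.interactionDensity P ψ p x

end Constants

/-- The integrals that define `⟨H^ph⟩` and `⟨H^I⟩` converge absolutely. -/
structure FiniteEnergy (C : Constants) (P : Polarization) (ψ : WaveFunction) : Prop where
  photon : Integrable (fun z : E3 × E3 => C.photonEnergyDensity ψ z.1 z.2)
  kernel : ∀ p x : E3, Integrable (fun z : E3 × E3 => C.interactionKernel P ψ p x z.1 z.2)
  interaction : Integrable (fun z : E3 × E3 => C.interactionDensity P ψ z.1 z.2)

/-- The Gaussian electron momentum density with value `r` at the origin. -/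
def gaussianDensity (r σ : ℝ) (k : E3) : ℝ := r * Real.exp (-‖k‖ ^ 2 / (2 * σ ^ 2))

/-- The trial wave function: a superposition of the vacuum with a spin-up electron field that is
entangled with the photon field. -/
def trialState (ρ ρel : E3 → ℝ) (τ : ℕ → ℕ → E3 → E3 → ℝ) (Z : E3 → ℝ) : WaveFunction :=
  fun p k mn S =>
    if S = {0} then
      ((τ mn.1 mn.2 p k * Real.sqrt (ρ p * ρel k)
        / Real.sqrt (mn.1.factorial * mn.2.factorial * Z k) : ℝ) : ℂ)
    else if S = ∅ ∧ mn = (0, 0) then ((Real.sqrt (1 - ρ p * ρel k) : ℝ) : ℂ)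
    else 0

/-- The conditions on the data of a trial wave function. -/
structure IsTrialData (C : Constants) (ρ ρel : E3 → ℝ) (τ : ℕ → ℕ → E3 → E3 → ℝ)
    (Z : E3 → ℝ) : Prop where
  measurable_ρ : Measurable ρ
  ρ_nonneg : ∀ p, 0 ≤ ρ p
  ρ_integrable : Integrable ρ
  ρ_normalized : C.ell ^ 3 * ∫ p : E3, ρ p = 1
  mul_le_one : ∀ p k, ρ p * ρel k ≤ 1
  measurable_τ : ∀ m n, Measurable (fun z : E3 × E3 => τ m n z.1 z.2)
  τ_zero_or_one : ∀ m n p k, τ m n p k = 0 ∨ τ m n p k = 1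
  Z_pos : ∀ k, 0 < Z k
  τ_sum : ∀ p k, HasSum
    (fun mn : ℕ × ℕ => τ mn.1 mn.2 p k / (mn.1.factorial * mn.2.factorial)) (Z k)

end RQED

end

/-!
The interaction energy of the trial state below is negative and, for photons of small momentum,
almost independent of that momentum, whereas the photon energy tends to zero with it. The current of
a free electron is, in momentum space, proportional to the velocity `c² k / ω(k)`
(`currentForm_spinor`), and `a_H + a_H†` has a positive expectation in every superposition of `|0,0⟩`
and `|1,0⟩` with positive coefficients. The photon state is therefore entangled with the electron:
it is proportional to `|0,0⟩ + |1,0⟩` if `k` lies in an octant `R` where `q λ ε^(H)(p) · k < 0`, and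
to `|0,2⟩` otherwise. The operators `a_H`, `a_V` and their adjoints couple `|0,2⟩` neither to itself
nor to `|0,0⟩` and `|1,0⟩`, so that only electrons with `k, k' ∈ R` contribute to the interaction
(`interactionKernel_eq`).

The interaction density is then `cos (p·x) ρ(p) ε^(H)(p) · Φ(x)` up to a constant
(`interactionDensity_eq`), where `Φ` is the current of the wave packet with amplitude
`g = √ρ^el` on `R` and `0` elsewhere, a combination of products of Fourier transforms of the
functions `g u_r`. These are in `L¹ ∩ L²`, so that by Plancherel `Φ` is integrable, in spite of the
jump of `g` at the boundary of `R`, and `∫ Φ` is `(2π)³` times the integral of the velocity over `R`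
with the weight `ρ^el` (`integral_packetCurrent`). By dominated convergence
`∫ cos (p·x) Φ(x) dx` is close to `∫ Φ` for small `p`, so that the interaction energy per photon
stays below a negative constant while the photon energy `ħ c |p|` tends to zero
(`exists_radius_energyPerPhoton_neg`).

The polarization vectors are only measurable in `p`. However, there are only eight sign patterns of
the components of `q λ ε^(H)(p)`, and for each of them the corresponding octant serves all `p` with
this pattern, because `∑ |ε_α| ≥ 1`. One of the patterns occurs on a set `B` of positive measure in
the ball of the smallest radius that is needed, and `ρ` is chosen constant on `B` and zero
elsewhere. All energies are proportional to `ρ^el(0)`, so this choice is independent of `ρ^el(0)`,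
which is restricted only by `ρ ρ^el ≤ 1`.
-/

open MeasureTheory
noncomputable section
namespace RQED

/-! ### Plancherel's theorem in `L¹ ∩ L²` -/

open FourierTransform SchwartzMap in
/-- On `L¹ ∩ L²` the unitary Fourier transform is given by the Fourier integral, because both have
the same pairing with every Schwartz function. -/
theorem fourier_toLp_ae_eq {V : Type*} [NormedAddCommGroup V] [InnerProductSpace ℝ V]
    [FiniteDimensional ℝ V] [MeasurableSpace V] [BorelSpace V] {f : V → ℂ}
    (hf : Integrable f) (hf2 : MemLp f 2) :
    (𝓕 (hf2.toLp f) : Lp ℂ 2 (volume : Measure V)) =ᵐ[volume] 𝓕 f := by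
  have hcont : Continuous (𝓕 f) :=
    VectorFourier.fourierIntegral_continuous Real.continuous_fourierChar continuous_inner hf
  refine ae_eq_of_integral_contDiff_smul_eq
    ((Lp.memLp (𝓕 (hf2.toLp f))).locallyIntegrable (by norm_num)) hcont.locallyIntegrable ?_
  intro g hg hgc
  have hg₁ : HasCompactSupport (Complex.ofRealCLM ∘ g) := hgc.comp_left rfl
  have hg₂ : ContDiff ℝ (⊤ : ℕ∞) (Complex.ofRealCLM ∘ g) := by fun_prop
  set G : 𝓢(V, ℂ) := hg₁.toSchwartzMap hg₂
  have h1 : ∫ x, G x • (𝓕 (hf2.toLp f) : Lp ℂ 2 (volume : Measure V)) x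
      = ∫ x, (𝓕 G) x • f x := by
    rw [← Lp.toTemperedDistribution_apply, ← Lp.fourier_toTemperedDistribution_eq,
      TemperedDistribution.fourier_apply, Lp.toTemperedDistribution_apply]
    refine integral_congr_ae ?_
    filter_upwards [hf2.coeFn_toLp] with x hx
    rw [hx]
  have h2 : ∫ x, (𝓕 (G : V → ℂ)) x • f x = ∫ x, G x • 𝓕 f x := by
    simpa using! VectorFourier.integral_bilin_fourierIntegral_eq_flip
      (ContinuousLinearMap.lsmul ℂ ℂ (E := ℂ)) (L := innerₗ V)
      Real.continuous_fourierChar continuous_inner G.integrable hf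
  have h3 : ∀ x, G x = (g x : ℂ) := fun x => rfl
  rw [SchwartzMap.fourier_coe] at h1
  simpa [h3] using h1.trans h2

open FourierTransform in
/-- Polarized Plancherel identity for functions in `L¹ ∩ L²`. -/
theorem integral_conj_fourier_mul_fourier {V : Type*} [NormedAddCommGroup V]
    [InnerProductSpace ℝ V] [FiniteDimensional ℝ V] [MeasurableSpace V] [BorelSpace V]
    {f g : V → ℂ} (hf : Integrable f) (hf2 : MemLp f 2) (hg : Integrable g) (hg2 : MemLp g 2) :
    Integrable (fun y => starRingEnd ℂ (𝓕 f y) * 𝓕 g y) ∧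
      ∫ y, starRingEnd ℂ (𝓕 f y) * 𝓕 g y = ∫ k, starRingEnd ℂ (f k) * g k := by
  have hF := fourier_toLp_ae_eq hf hf2
  have hG := fourier_toLp_ae_eq hg hg2
  have hFG : (fun y => inner ℂ ((𝓕 (hf2.toLp f) : Lp ℂ 2 (volume : Measure V)) y)
      ((𝓕 (hg2.toLp g) : Lp ℂ 2 (volume : Measure V)) y)) =ᵐ[volume]
      fun y => starRingEnd ℂ (𝓕 f y) * 𝓕 g y := by
    filter_upwards [hF, hG] with y h1 h2
    rw [h1, h2, RCLike.inner_apply, mul_comm]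
  refine ⟨(L2.integrable_inner _ _).congr hFG, ?_⟩
  rw [← integral_congr_ae hFG, ← L2.inner_def, Lp.inner_fourier_eq, L2.inner_def]
  refine integral_congr_ae ?_
  filter_upwards [hf2.coeFn_toLp, hg2.coeFn_toLp] with y h1 h2
  rw [h1, h2, RCLike.inner_apply, mul_comm]

/-- The superposition `∫ h(k) e^{ik·x} dk` of plane waves. -/
def planeWaveIntegral (h : E3 → ℂ) (x : E3) : ℂ := ∫ k : E3, h k * wave k x

open FourierTransform in
theorem planeWaveIntegral_eq_fourier (h : E3 → ℂ) (x : E3) :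
    planeWaveIntegral h x = 𝓕 h ((-(2 * Real.pi)⁻¹ : ℝ) • x) := by
  rw [planeWaveIntegral, Real.fourier_eq']
  congr 1; ext k
  rw [smul_eq_mul, mul_comm, wave, inner_smul_right, mul_comm Complex.I]
  congr 4
  field_simp

/-- Plancherel identity for superpositions of plane waves. -/
theorem integral_conj_planeWaveIntegral_mul {f g : E3 → ℂ} (hf : Integrable f)
    (hf2 : MemLp f 2) (hg : Integrable g) (hg2 : MemLp g 2) :
    Integrable (fun x => starRingEnd ℂ (planeWaveIntegral f x) * planeWaveIntegral g x) ∧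
      ∫ x, starRingEnd ℂ (planeWaveIntegral f x) * planeWaveIntegral g x
        = ((2 * Real.pi) ^ 3 : ℝ) * ∫ k, starRingEnd ℂ (f k) * g k := by
  obtain ⟨h1, h2⟩ := integral_conj_fourier_mul_fourier hf hf2 hg hg2
  simp only [planeWaveIntegral_eq_fourier]
  have hc : (-(2 * Real.pi)⁻¹ : ℝ) ≠ 0 := by
    have := Real.pi_pos
    simp [this.ne']
  refine ⟨h1.comp_smul hc, ?_⟩
  rw [Measure.integral_comp_smul volume
    (fun y => starRingEnd ℂ (FourierTransform.fourier f y) * FourierTransform.fourier g y), h2]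
  have : |((-(2 * Real.pi)⁻¹ : ℝ) ^ Module.finrank ℝ E3)⁻¹| = (2 * Real.pi) ^ 3 := by
    rw [finrank_euclideanSpace_fin, abs_inv, abs_pow, abs_neg, abs_inv,
      abs_of_pos (by positivity : 0 < 2 * Real.pi), inv_pow, inv_inv]
  rw [this, Complex.real_smul]

/-! ### Matrix elements of the electron current -/

/-- The matrix of the annihilation operator of mode `s`, with integer entries, so that matrix
elements of products can be evaluated by computation. -/
def annInt (s : Fin 4) : Matrix (Finset (Fin 4)) (Finset (Fin 4)) ℤ :=
  fun S T => if s ∉ S ∧ T = insert s S then (-1) ^ (S.filter (· < s)).card else 0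

theorem annEl_eq_map (s : Fin 4) : annEl s = (annInt s).map (Int.castRingHom ℂ) := by
  ext S T
  simp only [annEl, annInt, Matrix.map_apply]
  split_ifs <;> simp

theorem creEl_eq_map (s : Fin 4) : creEl s = (annInt s).transpose.map (Int.castRingHom ℂ) := by
  ext S T
  simp only [creEl, annEl, annInt, Matrix.map_apply, Matrix.conjTranspose_apply,
    Matrix.transpose_apply]
  split_ifs <;> simp

section
variable (s t : Fin 4)

/-! In the names of the lemmas on matrix elements, `one` stands for the state `|{0}⟩` with a single
spin up electron and `vac` for the state `|∅⟩`. -/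

theorem creEl_mul_annEl_one_one :
    (creEl s * annEl t) {0} {0} = if s = 0 ∧ t = 0 then 1 else 0 := by
  have : ((annInt s).transpose * annInt t) {0} {0} = if s = 0 ∧ t = 0 then 1 else 0 := by
    revert s t; decide +kernel
  rw [creEl_eq_map, annEl_eq_map, ← Matrix.map_mul, Matrix.map_apply, this]
  split_ifs <;> simp

theorem creEl_mul_annEl_one_vac : (creEl s * annEl t) {0} ∅ = 0 := by
  have : ((annInt s).transpose * annInt t) {0} ∅ = 0 := by revert s t; decide +kernel
  rw [creEl_eq_map, annEl_eq_map, ← Matrix.map_mul, Matrix.map_apply, this, map_zero]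

theorem creEl_mul_annEl_vac_one : (creEl s * annEl t) ∅ {0} = 0 := by
  have : ((annInt s).transpose * annInt t) ∅ {0} = 0 := by revert s t; decide +kernel
  rw [creEl_eq_map, annEl_eq_map, ← Matrix.map_mul, Matrix.map_apply, this, map_zero]

theorem creEl_mul_annEl_vac_vac : (creEl s * annEl t) ∅ ∅ = 0 := by
  have : ((annInt s).transpose * annInt t) ∅ ∅ = 0 := by revert s t; decide +kernel
  rw [creEl_eq_map, annEl_eq_map, ← Matrix.map_mul, Matrix.map_apply, this, map_zero]

theorem annEl_mul_creEl_one_one :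
    (annEl s * creEl t) {0} {0} = if s = t ∧ s ≠ 0 then 1 else 0 := by
  have : (annInt s * (annInt t).transpose) {0} {0} = if s = t ∧ s ≠ 0 then 1 else 0 := by
    revert s t; decide +kernel
  rw [creEl_eq_map, annEl_eq_map, ← Matrix.map_mul, Matrix.map_apply, this]
  split_ifs <;> simp

theorem annEl_mul_creEl_one_vac : (annEl s * creEl t) {0} ∅ = 0 := by
  have : (annInt s * (annInt t).transpose) {0} ∅ = 0 := by revert s t; decide +kernel
  rw [creEl_eq_map, annEl_eq_map, ← Matrix.map_mul, Matrix.map_apply, this, map_zero]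

theorem annEl_mul_creEl_vac_one : (annEl s * creEl t) ∅ {0} = 0 := by
  have : (annInt s * (annInt t).transpose) ∅ {0} = 0 := by revert s t; decide +kernel
  rw [creEl_eq_map, annEl_eq_map, ← Matrix.map_mul, Matrix.map_apply, this, map_zero]

theorem annEl_mul_annEl_one_one : (annEl s * annEl t) {0} {0} = 0 := by
  have : (annInt s * annInt t) {0} {0} = 0 := by revert s t; decide +kernel
  rw [annEl_eq_map, annEl_eq_map, ← Matrix.map_mul, Matrix.map_apply, this, map_zero]

theorem annEl_mul_annEl_one_vac : (annEl s * annEl t) {0} ∅ = 0 := by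
  have : (annInt s * annInt t) {0} ∅ = 0 := by revert s t; decide +kernel
  rw [annEl_eq_map, annEl_eq_map, ← Matrix.map_mul, Matrix.map_apply, this, map_zero]

theorem annEl_mul_annEl_vac_one : (annEl s * annEl t) ∅ {0} = 0 := by
  have : (annInt s * annInt t) ∅ {0} = 0 := by revert s t; decide +kernel
  rw [annEl_eq_map, annEl_eq_map, ← Matrix.map_mul, Matrix.map_apply, this, map_zero]

theorem creEl_mul_creEl_one_one : (creEl s * creEl t) {0} {0} = 0 := by
  have : ((annInt s).transpose * (annInt t).transpose) {0} {0} = 0 := by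
    revert s t; decide +kernel
  rw [creEl_eq_map, creEl_eq_map, ← Matrix.map_mul, Matrix.map_apply, this, map_zero]

theorem creEl_mul_creEl_one_vac : (creEl s * creEl t) {0} ∅ = 0 := by
  have : ((annInt s).transpose * (annInt t).transpose) {0} ∅ = 0 := by
    revert s t; decide +kernel
  rw [creEl_eq_map, creEl_eq_map, ← Matrix.map_mul, Matrix.map_apply, this, map_zero]

theorem creEl_mul_creEl_vac_one : (creEl s * creEl t) ∅ {0} = 0 := by
  have : ((annInt s).transpose * (annInt t).transpose) ∅ {0} = 0 := by
    revert s t; decide +kernel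
  rw [creEl_eq_map, creEl_eq_map, ← Matrix.map_mul, Matrix.map_apply, this, map_zero]

end

/-- The coefficient of the Dirac field that belongs to mode `s`: a spinor times a plane wave,
of positive frequency for the electron and of negative frequency for the positron. -/
def Constants.modeFun (C : Constants) (s : Fin 4) (k x : E3) (r : Fin 4) : ℂ :=
  C.spinor k s r * wave (if s = 0 ∨ s = 1 then k else -k) x

theorem Constants.dirac_eq (C : Constants) (r : Fin 4) (k x : E3) :
    C.dirac r k x = C.modeFun 0 k x r • annEl 0 + C.modeFun 1 k x r • annEl 1
      + (C.modeFun 2 k x r • creEl 2 + C.modeFun 3 k x r • creEl 3) := by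
  simp [Constants.dirac, Constants.modeFun]

theorem Constants.dirac_conjTranspose_eq (C : Constants) (r : Fin 4) (k x : E3) :
    (C.dirac r k x).conjTranspose
      = starRingEnd ℂ (C.modeFun 0 k x r) • creEl 0 + starRingEnd ℂ (C.modeFun 1 k x r) • creEl 1
      + (starRingEnd ℂ (C.modeFun 2 k x r) • annEl 2
        + starRingEnd ℂ (C.modeFun 3 k x r) • annEl 3) := by
  simp [Constants.dirac_eq, creEl, Matrix.conjTranspose_add, Matrix.conjTranspose_smul]

section
variable (C : Constants) (r t : Fin 4) (k k' x : E3)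

theorem Constants.dirac_conj_mul_dirac_one_one :
    ((C.dirac t k x).conjTranspose * C.dirac r k' x) {0} {0}
      = starRingEnd ℂ (C.modeFun 0 k x t) * C.modeFun 0 k' x r
        + starRingEnd ℂ (C.modeFun 2 k x t) * C.modeFun 2 k' x r
        + starRingEnd ℂ (C.modeFun 3 k x t) * C.modeFun 3 k' x r := by
  rw [Constants.dirac_conjTranspose_eq, Constants.dirac_eq]
  simp [add_mul, mul_add,
    creEl_mul_annEl_one_one, annEl_mul_creEl_one_one, annEl_mul_annEl_one_one,
    creEl_mul_creEl_one_one]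
  ring

theorem Constants.dirac_mul_dirac_conj_one_one :
    (C.dirac r k x * (C.dirac t k' x).conjTranspose) {0} {0}
      = C.modeFun 1 k x r * starRingEnd ℂ (C.modeFun 1 k' x t) := by
  rw [Constants.dirac_conjTranspose_eq, Constants.dirac_eq]
  simp [add_mul, mul_add,
    creEl_mul_annEl_one_one, annEl_mul_creEl_one_one, annEl_mul_annEl_one_one,
    creEl_mul_creEl_one_one]
  ring

theorem Constants.dirac_conj_mul_dirac_one_vac :
    ((C.dirac t k x).conjTranspose * C.dirac r k' x) {0} ∅ = 0 := by
  rw [Constants.dirac_conjTranspose_eq, Constants.dirac_eq]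
  simp [add_mul, mul_add,
    creEl_mul_annEl_one_vac, annEl_mul_creEl_one_vac, annEl_mul_annEl_one_vac,
    creEl_mul_creEl_one_vac]

theorem Constants.dirac_mul_dirac_conj_one_vac :
    (C.dirac r k x * (C.dirac t k' x).conjTranspose) {0} ∅ = 0 := by
  rw [Constants.dirac_conjTranspose_eq, Constants.dirac_eq]
  simp [add_mul, mul_add,
    creEl_mul_annEl_one_vac, annEl_mul_creEl_one_vac, annEl_mul_annEl_one_vac,
    creEl_mul_creEl_one_vac]

theorem Constants.dirac_conj_mul_dirac_vac_one :
    ((C.dirac t k x).conjTranspose * C.dirac r k' x) ∅ {0} = 0 := by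
  rw [Constants.dirac_conjTranspose_eq, Constants.dirac_eq]
  simp [add_mul, mul_add,
    creEl_mul_annEl_vac_one, annEl_mul_creEl_vac_one, annEl_mul_annEl_vac_one,
    creEl_mul_creEl_vac_one]

theorem Constants.dirac_mul_dirac_conj_vac_one :
    (C.dirac r k x * (C.dirac t k' x).conjTranspose) ∅ {0} = 0 := by
  rw [Constants.dirac_conjTranspose_eq, Constants.dirac_eq]
  simp [add_mul, mul_add,
    creEl_mul_annEl_vac_one, annEl_mul_creEl_vac_one, annEl_mul_annEl_vac_one,
    creEl_mul_creEl_vac_one]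

end

/-- The sesquilinear form `(a, b) ↦ a† γ⁰ γ^α b` on spinors. -/
def currentForm (α : Fin 3) (a b : Fin 4 → ℂ) : ℂ :=
  ∑ t : Fin 4, ∑ r : Fin 4, (gamma0 * gammaSp α) t r * (starRingEnd ℂ (a t) * b r)

theorem sum_mul_sum_mul_eq_mul_apply {n R : Type*} [Fintype n] [CommSemiring R]
    (A B : Matrix n n R) (X : n → n → R) :
    ∑ r, ∑ r', B r r' * ∑ t, A t r * X t r' = ∑ t, ∑ r', (A * B) t r' * X t r' := by
  simp only [Matrix.mul_apply, Finset.sum_mul, Finset.mul_sum]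
  rw [Finset.sum_comm]
  conv_rhs => rw [Finset.sum_comm]
  refine Finset.sum_congr rfl fun r' _ => ?_
  rw [Finset.sum_comm]
  exact Finset.sum_congr rfl fun t _ => Finset.sum_congr rfl fun r _ => by ring

theorem Constants.current_apply (C : Constants) (α : Fin 3) (k k' x : E3)
    (S T : Finset (Fin 4)) :
    C.current α k k' x S T
      = (1 / 2 : ℂ) * (∑ t : Fin 4, ∑ r : Fin 4, (gamma0 * gammaSp α) t r *
          ((C.dirac t k x).conjTranspose * C.dirac r k' x) S T)
      - (1 / 2 : ℂ) * (∑ t : Fin 4, ∑ r : Fin 4, (gamma0 * gammaSp α) t r *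
          (C.dirac r k x * (C.dirac t k' x).conjTranspose) S T) := by
  rw [← sum_mul_sum_mul_eq_mul_apply gamma0 (gammaSp α)
      (fun t r => ((C.dirac t k x).conjTranspose * C.dirac r k' x) S T),
    ← sum_mul_sum_mul_eq_mul_apply gamma0 (gammaSp α)
      (fun t r => (C.dirac r k x * (C.dirac t k' x).conjTranspose) S T),
    Finset.sum_comm (f := fun r r' => gammaSp α r r' * ∑ t, gamma0 t r *
      (C.dirac r' k x * (C.dirac t k' x).conjTranspose) S T)]
  simp only [Constants.current, Constants.diracAdj, Matrix.sub_apply, Matrix.smul_apply,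
    Matrix.sum_apply, smul_eq_mul, Matrix.mul_sum, Matrix.sum_mul, Matrix.smul_mul,
    Matrix.mul_smul]

/-- The matrix element of the current in the spin up electron state: the electron mode itself,
the two positron modes of the negative energy sea, and, from the second ordering of the field
operators, the empty spin down mode with the opposite sign. -/
theorem Constants.current_one_one (C : Constants) (α : Fin 3) (k k' x : E3) :
    C.current α k k' x {0} {0}
      = (1 / 2 : ℂ) * (currentForm α (C.modeFun 0 k x) (C.modeFun 0 k' x)
          + currentForm α (C.modeFun 2 k x) (C.modeFun 2 k' x)
          + currentForm α (C.modeFun 3 k x) (C.modeFun 3 k' x)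
          - currentForm α (C.modeFun 1 k' x) (C.modeFun 1 k x)) := by
  rw [Constants.current_apply]
  simp only [Constants.dirac_conj_mul_dirac_one_one, Constants.dirac_mul_dirac_conj_one_one,
    currentForm, ← Finset.sum_add_distrib, ← Finset.sum_sub_distrib, ← mul_sub]
  congr 1
  refine Finset.sum_congr rfl fun t _ => Finset.sum_congr rfl fun r _ => ?_
  ring

/-- The current conserves the charge, so that it does not couple the electron to the vacuum. -/
theorem Constants.current_one_vac (C : Constants) (α : Fin 3) (k k' x : E3) :
    C.current α k k' x {0} ∅ = 0 := by
  simp [Constants.current_apply, Constants.dirac_conj_mul_dirac_one_vac,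
    Constants.dirac_mul_dirac_conj_one_vac]

theorem Constants.current_vac_one (C : Constants) (α : Fin 3) (k k' x : E3) :
    C.current α k k' x ∅ {0} = 0 := by
  simp [Constants.current_apply, Constants.dirac_conj_mul_dirac_vac_one,
    Constants.dirac_mul_dirac_conj_vac_one]

/-! ### Dirac spinors -/

namespace Constants
variable (C : Constants)

theorem omega_pos (k : E3) : 0 < C.omega k := by
  have := C.kappa_pos
  exact mul_pos C.c_pos (Real.sqrt_pos.2 (by positivity))

theorem c_mul_kappa_le_omega (k : E3) : C.c * C.kappa ≤ C.omega k := by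
  refine mul_le_mul_of_nonneg_left (Real.le_sqrt_of_sq_le ?_) C.c_pos.le
  nlinarith [sq_nonneg ‖k‖]

theorem c_mul_norm_le_omega (k : E3) : C.c * ‖k‖ ≤ C.omega k := by
  refine mul_le_mul_of_nonneg_left (Real.le_sqrt_of_sq_le ?_) C.c_pos.le
  nlinarith [sq_nonneg C.kappa]

theorem continuous_omega : Continuous C.omega := by
  unfold omega; fun_prop

/-- The expectation of `γ⁰ γ^α` in each free spinor is `ν` times the group velocity in units
of the speed of light, and it has the same sign for electrons and positrons. -/
theorem currentForm_spinor (α : Fin 3) (k : E3) (s : Fin 4) :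
    currentForm α (C.spinor k s) (C.spinor k s)
      = ((C.nu * C.c * k α / C.omega k : ℝ) : ℂ) := by
  have hω := C.omega_pos k
  have hκ : 0 < C.c * C.kappa := mul_pos C.c_pos C.kappa_pos
  have key : 2 * (Real.sqrt (C.nu * (C.omega k + C.c * C.kappa) / (2 * C.omega k))) ^ 2
      * (C.c / (C.omega k + C.c * C.kappa)) * k α = C.nu * C.c * k α / C.omega k := by
    have := C.nu_pos
    rw [Real.sq_sqrt (by positivity)]
    field_simp
  rw [← key]
  simp only [spinor]
  generalize Real.sqrt (C.nu * (C.omega k + C.c * C.kappa) / (2 * C.omega k)) = N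
  generalize C.c / (C.omega k + C.c * C.kappa) = b
  have hI : Complex.I ^ 2 = -1 := Complex.I_sq
  fin_cases α <;> fin_cases s <;>
    · simp [currentForm, gamma0, gammaSp, Fin.sum_univ_four, Matrix.mul_apply]
      ring_nf
      try simp only [hI]
      try ring_nf

theorem norm_spinor_le (k : E3) (s r : Fin 4) : ‖C.spinor k s r‖ ≤ Real.sqrt C.nu * 2 := by
  have hω := C.omega_pos k
  have hκ : 0 < C.c * C.kappa := mul_pos C.c_pos C.kappa_pos
  have hν := C.nu_pos
  have hc := C.c_pos
  have hN : Real.sqrt (C.nu * (C.omega k + C.c * C.kappa) / (2 * C.omega k)) ≤ Real.sqrt C.nu := by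
    refine Real.sqrt_le_sqrt ?_
    rw [div_le_iff₀ (by positivity)]
    nlinarith [C.c_mul_kappa_le_omega k]
  have hk : ∀ i, C.c / (C.omega k + C.c * C.kappa) * |k i| ≤ 1 := by
    intro i
    rw [div_mul_eq_mul_div, div_le_one (by positivity)]
    have h1 : |k i| ≤ ‖k‖ := by simpa using PiLp.norm_apply_le k i
    nlinarith [C.c_mul_norm_le_omega k]
  have hb : 0 ≤ C.c / (C.omega k + C.c * C.kappa) := by positivity
  simp only [spinor, Pi.smul_apply, smul_eq_mul, norm_mul]
  rw [Complex.norm_real, Real.norm_of_nonneg (Real.sqrt_nonneg _)]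
  refine mul_le_mul hN ?_ (norm_nonneg _) (Real.sqrt_nonneg _)
  generalize C.c / (C.omega k + C.c * C.kappa) = b at *
  have h1 : ∀ i, ‖(b : ℂ) * (k i : ℂ)‖ ≤ 2 := fun i => by
    rw [norm_mul, Complex.norm_real, Complex.norm_real, Real.norm_of_nonneg hb,
      Real.norm_eq_abs]
    linarith [hk i]
  have h2 : ‖(b : ℂ) * ((k 0 : ℂ) + Complex.I * (k 1 : ℂ))‖ ≤ 2 := by
    rw [norm_mul, Complex.norm_real, Real.norm_of_nonneg hb]
    have := norm_add_le (k 0 : ℂ) (Complex.I * (k 1 : ℂ))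
    rw [norm_mul, Complex.norm_I, one_mul, Complex.norm_real, Complex.norm_real,
      Real.norm_eq_abs, Real.norm_eq_abs] at this
    nlinarith [hk 0, hk 1, mul_le_mul_of_nonneg_left this hb]
  have h3 : ‖(b : ℂ) * ((k 0 : ℂ) - Complex.I * (k 1 : ℂ))‖ ≤ 2 := by
    rw [norm_mul, Complex.norm_real, Real.norm_of_nonneg hb]
    have := norm_sub_le (k 0 : ℂ) (Complex.I * (k 1 : ℂ))
    rw [norm_mul, Complex.norm_I, one_mul, Complex.norm_real, Complex.norm_real,
      Real.norm_eq_abs, Real.norm_eq_abs] at this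
    nlinarith [hk 0, hk 1, mul_le_mul_of_nonneg_left this hb]
  have h4 : ‖(1 : ℂ)‖ ≤ 2 := by norm_num
  have h5 : ‖(0 : ℂ)‖ ≤ 2 := by norm_num
  fin_cases s <;> fin_cases r <;>
    first | exact h4 | exact h5 | exact h1 2 | exact h2 | exact h3 | exact (norm_neg _).trans_le (h1 2)

theorem measurable_spinor (s r : Fin 4) : Measurable fun k => C.spinor k s r := by
  have hω := C.continuous_omega.measurable
  have hk : ∀ i : Fin 3, Measurable fun k : E3 => (k i : ℂ) := fun i =>
    (Complex.continuous_ofReal.comp (PiLp.continuous_apply 2 _ i)).measurable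
  have h0 := hk 0
  have h1 := hk 1
  have h2 := hk 2
  simp only [spinor, Pi.smul_apply, smul_eq_mul]
  refine Measurable.mul (by fun_prop) ?_
  have hb : Measurable fun k : E3 => ((C.c / (C.omega k + C.c * C.kappa) : ℝ) : ℂ) := by fun_prop
  generalize (fun k : E3 => ((C.c / (C.omega k + C.c * C.kappa) : ℝ) : ℂ)) = b at *
  fin_cases s <;> fin_cases r <;> simp <;> fun_prop

end Constants
/-! ### The current of an electron wave packet -/

theorem conj_currentForm (α : Fin 3) (a b : Fin 4 → ℂ) :
    starRingEnd ℂ (currentForm α a b) = currentForm α b a := by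
  have hM : ∀ t r, starRingEnd ℂ ((gamma0 * gammaSp α) t r) = (gamma0 * gammaSp α) r t := by
    intro t r
    fin_cases α <;> fin_cases t <;> fin_cases r <;>
      simp [gamma0, gammaSp, Matrix.mul_apply, Fin.sum_univ_four]
  simp only [currentForm, map_sum, map_mul, hM, Complex.conj_conj]
  rw [Finset.sum_comm]
  refine Finset.sum_congr rfl fun t _ => Finset.sum_congr rfl fun r _ => ?_
  ring

theorem currentForm_smul_smul (α : Fin 3) (u v : ℝ) (a b : Fin 4 → ℂ) :
    currentForm α (fun r => (u : ℂ) * a r) (fun r => (v : ℂ) * b r)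
      = (u : ℂ) * v * currentForm α a b := by
  simp only [currentForm, map_mul, Complex.conj_ofReal, Finset.mul_sum]
  refine Finset.sum_congr rfl fun t _ => Finset.sum_congr rfl fun r _ => ?_
  ring

theorem integrable_conj {f : E3 → ℂ} (hf : Integrable f) :
    Integrable fun k => starRingEnd ℂ (f k) :=
  hf.congr' (Complex.continuous_conj.comp_aestronglyMeasurable hf.1)
    (.of_forall fun k => by simp)

section
variable {X : Type*} [MeasurableSpace X] {μ : Measure X}

theorem integral_sum_sum_mul (M : Matrix (Fin 4) (Fin 4) ℂ) {F : Fin 4 → Fin 4 → X → ℂ}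
    (hF : ∀ t r, Integrable (F t r) μ) :
    ∫ x, ∑ t, ∑ r, M t r * F t r x ∂μ = ∑ t, ∑ r, M t r * ∫ x, F t r x ∂μ := by
  have h := fun t r => (hF t r).const_mul (M t r)
  rw [integral_finsetSum _ fun t _ => integrable_finsetSum _ fun r _ => h t r]
  refine Finset.sum_congr rfl fun t _ => ?_
  rw [integral_finsetSum _ fun r _ => h t r]
  exact Finset.sum_congr rfl fun r _ => integral_const_mul _ _

theorem integral_half_mul_add_add_sub {f₀ f₁ f₂ f₃ : X → ℂ} (h₀ : Integrable f₀ μ)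
    (h₁ : Integrable f₁ μ) (h₂ : Integrable f₂ μ) (h₃ : Integrable f₃ μ) :
    ∫ x, (1 / 2 : ℂ) * (f₀ x + f₁ x + f₂ x - f₃ x) ∂μ
      = (1 / 2 : ℂ) * (∫ x, f₀ x ∂μ + ∫ x, f₁ x ∂μ + ∫ x, f₂ x ∂μ - ∫ x, f₃ x ∂μ) := by
  have h01 : Integrable (fun x => f₀ x + f₁ x) μ := h₀.add h₁
  have h012 : Integrable (fun x => f₀ x + f₁ x + f₂ x) μ := h01.add h₂
  rw [integral_const_mul, integral_sub h012 h₃, integral_add h01 h₂, integral_add h₀ h₁]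

end

theorem integrable_currentForm_prod (α : Fin 3) {a b : E3 → Fin 4 → ℂ}
    (ha : ∀ r, Integrable fun k => a k r) (hb : ∀ r, Integrable fun k => b k r) :
    Integrable fun z : E3 × E3 => currentForm α (a z.1) (b z.2) :=
  integrable_finsetSum _ fun t _ => integrable_finsetSum _ fun r _ =>
    ((integrable_conj (ha t)).mul_prod (hb r)).const_mul _

theorem integral_currentForm_prod (α : Fin 3) {a b : E3 → Fin 4 → ℂ}
    (ha : ∀ r, Integrable fun k => a k r) (hb : ∀ r, Integrable fun k => b k r) :
    ∫ z : E3 × E3, currentForm α (a z.1) (b z.2)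
      = currentForm α (fun r => ∫ k, a k r) (fun r => ∫ k, b k r) := by
  have h : ∀ t r, Integrable fun z : E3 × E3 => starRingEnd ℂ (a z.1 t) * b z.2 r := fun t r =>
    (integrable_conj (ha t)).mul_prod (hb r)
  simp only [currentForm]
  rw [integral_sum_sum_mul _ h]
  refine Finset.sum_congr rfl fun t _ => Finset.sum_congr rfl fun r _ => ?_
  rw [← integral_conj]
  congr 1
  exact integral_prod_mul (fun k => starRingEnd ℂ (a k t)) (fun k => b k r)

namespace Constants
variable (C : Constants)

/-- The superposition `∫ g(k) u(k) e^{±ik·x} dk` of free solutions of type `s`. -/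
def modeIntegral (g : E3 → ℝ) (s : Fin 4) (x : E3) (r : Fin 4) : ℂ :=
  ∫ k : E3, (g k : ℂ) * C.modeFun s k x r

/-- The current `∫∫ g(k) g(k') ⟨{0}| J^α_{k,k'}(x) |{0}⟩ dk dk'` of a one-electron wave packet with
real amplitude `g`. -/
def packetCurrent (g : E3 → ℝ) (α : Fin 3) (x : E3) : ℂ :=
  (1 / 2 : ℂ) * (currentForm α (C.modeIntegral g 0 x) (C.modeIntegral g 0 x)
    + currentForm α (C.modeIntegral g 2 x) (C.modeIntegral g 2 x)
    + currentForm α (C.modeIntegral g 3 x) (C.modeIntegral g 3 x)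
    - currentForm α (C.modeIntegral g 1 x) (C.modeIntegral g 1 x))

theorem conj_packetCurrent (g : E3 → ℝ) (α : Fin 3) (x : E3) :
    starRingEnd ℂ (C.packetCurrent g α x) = C.packetCurrent g α x := by
  simp [packetCurrent, conj_currentForm, map_ofNat]

variable {g : E3 → ℝ}

theorem memLp_mul_spinor {p : ENNReal} (hg : MemLp g p) (s r : Fin 4) :
    MemLp (fun k => (g k : ℂ) * C.spinor k s r) p := by
  refine hg.of_le_mul (c := Real.sqrt C.nu * 2) ?_ (.of_forall fun k => ?_)
  · exact (Complex.continuous_ofReal.comp_aestronglyMeasurable hg.1).mul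
      (C.measurable_spinor s r).aestronglyMeasurable
  · rw [norm_mul, Complex.norm_real, mul_comm]
    exact mul_le_mul_of_nonneg_right (C.norm_spinor_le k s r) (norm_nonneg _)

theorem measurable_wave (x : E3) : Measurable fun k => wave k x := by
  unfold wave
  exact Continuous.measurable (by fun_prop)

theorem norm_wave (k x : E3) : ‖wave k x‖ = 1 := by
  rw [wave, mul_comm, Complex.norm_exp_ofReal_mul_I]

theorem integrable_mul_modeFun (hg : Integrable g) (s : Fin 4) (x : E3) (r : Fin 4) :
    Integrable fun k => (g k : ℂ) * C.modeFun s k x r := by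
  have h := memLp_one_iff_integrable.1 (C.memLp_mul_spinor (memLp_one_iff_integrable.2 hg) s r)
  have hw : Measurable fun k => wave (if s = 0 ∨ s = 1 then k else -k) x := by
    split_ifs
    · exact measurable_wave x
    · exact (measurable_wave x).comp measurable_neg
  refine (h.mul_bdd (c := 1) hw.aestronglyMeasurable
    (.of_forall fun k => (norm_wave _ x).le)).congr (.of_forall fun k => ?_)
  simp only [modeFun]; ring

theorem modeIntegral_eq (s : Fin 4) (x : E3) (r : Fin 4) :
    C.modeIntegral g s x r = planeWaveIntegral (fun k => (g k : ℂ) * C.spinor k s r)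
      (if s = 0 ∨ s = 1 then x else -x) := by
  unfold modeIntegral planeWaveIntegral modeFun
  congr 1; ext k
  split_ifs <;> simp [wave, mul_assoc]

/-- By Plancherel, the `L²` functions `modeIntegral` have a current in `L¹`, and its integral is
the momentum space average of the velocity. -/
theorem integral_currentForm_modeIntegral (hg : Integrable g) (hg2 : MemLp g 2) (α : Fin 3)
    (s : Fin 4) :
    Integrable (fun x => currentForm α (C.modeIntegral g s x) (C.modeIntegral g s x)) ∧
      ∫ x, currentForm α (C.modeIntegral g s x) (C.modeIntegral g s x)
        = (((2 * Real.pi) ^ 3 * ∫ k, g k ^ 2 * (C.nu * C.c * k α / C.omega k) : ℝ) : ℂ) := by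
  set h : Fin 4 → E3 → ℂ := fun r k => (g k : ℂ) * C.spinor k s r with hh
  have h1 : ∀ r, Integrable (h r) := fun r =>
    memLp_one_iff_integrable.1 (C.memLp_mul_spinor (memLp_one_iff_integrable.2 hg) s r)
  have h2 : ∀ r, MemLp (h r) 2 := fun r => C.memLp_mul_spinor hg2 s r
  have hP := fun t r => integral_conj_planeWaveIntegral_mul (h1 t) (h2 t) (h1 r) (h2 r)
  have hmom : ∀ t r, Integrable fun k => starRingEnd ℂ (h t k) * h r k := fun t r =>
    (h2 t).star.integrable_mul (h2 r)
  have key : Integrable (fun x => currentForm α (fun r => planeWaveIntegral (h r) x)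
        (fun r => planeWaveIntegral (h r) x)) ∧
      ∫ x, currentForm α (fun r => planeWaveIntegral (h r) x) (fun r => planeWaveIntegral (h r) x)
        = (((2 * Real.pi) ^ 3 * ∫ k, g k ^ 2 * (C.nu * C.c * k α / C.omega k) : ℝ) : ℂ) := by
    have hi := fun t r => (hP t r).1.const_mul ((gamma0 * gammaSp α) t r)
    refine ⟨integrable_finsetSum _ fun t _ => integrable_finsetSum _ fun r _ => hi t r, ?_⟩
    have hk : ∀ k, currentForm α (fun r => h r k) (fun r => h r k)
        = ((g k ^ 2 * (C.nu * C.c * k α / C.omega k) : ℝ) : ℂ) := by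
      intro k
      rw [hh, currentForm_smul_smul α (g k) (g k) (C.spinor k s) (C.spinor k s),
        currentForm_spinor]
      push_cast; ring
    rw [Complex.ofReal_mul, ← integral_complex_ofReal]
    simp_rw [← hk]
    simp only [currentForm]
    rw [integral_sum_sum_mul _ fun t r => (hP t r).1, integral_sum_sum_mul _ hmom,
      Finset.mul_sum]
    refine Finset.sum_congr rfl fun t _ => ?_
    rw [Finset.mul_sum]
    refine Finset.sum_congr rfl fun r _ => ?_
    rw [(hP t r).2]
    ring
  have he : ∀ x, C.modeIntegral g s x
      = fun r => planeWaveIntegral (h r) (if s = 0 ∨ s = 1 then x else -x) := fun x =>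
    funext fun r => C.modeIntegral_eq s x r
  simp only [he]
  split_ifs
  · exact key
  · refine ⟨key.1.comp_neg, ?_⟩
    rw [← key.2]
    exact integral_neg_eq_self (fun x => currentForm α (fun r => planeWaveIntegral (h r) x)
      (fun r => planeWaveIntegral (h r) x)) volume

theorem integrable_packetCurrent (hg : Integrable g) (hg2 : MemLp g 2) (α : Fin 3) :
    Integrable (C.packetCurrent g α) :=
  have h := fun s => (C.integral_currentForm_modeIntegral hg hg2 α s).1
  ((((h 0).add (h 2)).add (h 3)).sub (h 1)).const_mul _

/-- The spin up electron and the vacuum fluctuations of the charge-symmetrized current combine to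
the velocity of one electron: `(1 + 2 - 1) / 2 = 1`. -/
theorem integral_packetCurrent (hg : Integrable g) (hg2 : MemLp g 2) (α : Fin 3) :
    ∫ x, C.packetCurrent g α x
      = (((2 * Real.pi) ^ 3 * ∫ k, g k ^ 2 * (C.nu * C.c * k α / C.omega k) : ℝ) : ℂ) := by
  have h := fun s => C.integral_currentForm_modeIntegral hg hg2 α s
  simp only [packetCurrent]
  rw [integral_half_mul_add_add_sub (h 0).1 (h 2).1 (h 3).1 (h 1).1]
  simp only [(h _).2]
  ring

theorem integral_current_eq (hg : Integrable g) (α : Fin 3) (x : E3) :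
    Integrable (fun z : E3 × E3 => (g z.1 : ℂ) * g z.2 * C.current α z.1 z.2 x {0} {0}) ∧
      ∫ z : E3 × E3, (g z.1 : ℂ) * g z.2 * C.current α z.1 z.2 x {0} {0}
        = C.packetCurrent g α x := by
  set a : Fin 4 → E3 → Fin 4 → ℂ := fun s k r => (g k : ℂ) * C.modeFun s k x r with ha
  have h1 : ∀ s r, Integrable fun k => a s k r := fun s r => C.integrable_mul_modeFun hg s x r
  have he : (fun z : E3 × E3 => (g z.1 : ℂ) * g z.2 * C.current α z.1 z.2 x {0} {0})
      = fun z => (1 / 2 : ℂ) * (currentForm α (a 0 z.1) (a 0 z.2)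
        + currentForm α (a 2 z.1) (a 2 z.2) + currentForm α (a 3 z.1) (a 3 z.2)
        - currentForm α (a 1 z.2) (a 1 z.1)) := by
    ext z
    simp only [ha, currentForm_smul_smul, current_one_one]
    ring
  have hi := fun s => integrable_currentForm_prod α (h1 s) (h1 s)
  have hs : Integrable fun z : E3 × E3 => currentForm α (a 1 z.2) (a 1 z.1) := (hi 1).swap
  have hv : ∫ z : E3 × E3, currentForm α (a 1 z.2) (a 1 z.1)
      = currentForm α (C.modeIntegral g 1 x) (C.modeIntegral g 1 x) := by
    have := integral_currentForm_prod α (h1 1) (h1 1)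
    exact (integral_prod_swap (μ := (volume : Measure E3)) (ν := (volume : Measure E3))
      fun z : E3 × E3 => currentForm α (a 1 z.1) (a 1 z.2)).trans this
  rw [he]
  refine ⟨((((hi 0).add (hi 2)).add (hi 3)).sub hs).const_mul _, ?_⟩
  rw [integral_half_mul_add_add_sub (hi 0) (hi 2) (hi 3) hs, hv]
  simp only [integral_currentForm_prod α (h1 _) (h1 _)]
  rfl

end Constants
/-! ### Expectations in the trial state -/

/-- The Fock vector `a (|0,0⟩ + |1,0⟩) ⊗ |{0}⟩ + b |0,2⟩ ⊗ |{0}⟩ + v |0,0⟩ ⊗ |∅⟩`. The photon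
states of the first part are coupled by `a_H`, while `a_H`, `a_V` and their adjoints couple `|0,2⟩`
neither to itself nor to these. -/
def fockTriple (a b v : ℝ) : FockVec := fun mn S =>
  if S = {0} then
    if mn = (0, 0) ∨ mn = (1, 0) then (a : ℂ) else if mn = (0, 2) then (b : ℂ) else 0
  else if S = ∅ ∧ mn = (0, 0) then (v : ℂ) else 0

theorem fockTriple_eq_zero {a b v : ℝ} {mn : ℕ × ℕ} {S : Finset (Fin 4)}
    (h : S ≠ {0} ∧ S ≠ ∅) : fockTriple a b v mn S = 0 := by
  simp [fockTriple, h.1, h.2]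

theorem braket_fockTriple (a b v : ℝ) (g : FockVec) :
    braket (fockTriple a b v) g
      = a * (g (0, 0) {0} + g (1, 0) {0}) + b * g (0, 2) {0} + v * g (0, 0) ∅ := by
  have h1 : ∀ mn, ∑ S, starRingEnd ℂ (fockTriple a b v mn S) * g mn S
      = starRingEnd ℂ (fockTriple a b v mn {0}) * g mn {0}
        + starRingEnd ℂ (fockTriple a b v mn ∅) * g mn ∅ := fun mn =>
    Fintype.sum_eq_add {0} ∅ (by decide) fun S hS => by simp [fockTriple_eq_zero hS]
  rw [braket, tsum_congr h1, tsum_eq_sum (s := {(0, 0), (1, 0), (0, 2)})]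
  · simp [fockTriple]
    ring
  · rintro mn hmn
    simp only [Finset.mem_insert, Finset.mem_singleton, not_or] at hmn
    simp [fockTriple, hmn.1, hmn.2.1, hmn.2.2]

theorem applyEl_fockTriple (T : ElOp) (a b v : ℝ) (mn : ℕ × ℕ) (S : Finset (Fin 4)) :
    applyEl T (fockTriple a b v) mn S
      = T S {0} * fockTriple a b v mn {0} + T S ∅ * fockTriple a b v mn ∅ :=
  Fintype.sum_eq_add (f := fun U => T S U * fockTriple a b v mn U) {0} ∅ (by decide)
    fun U hU => by simp [fockTriple_eq_zero hU]

namespace Constants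
variable (C : Constants)

theorem braket_photonHamiltonian_fockTriple (p : E3) (a b v : ℝ) :
    braket (fockTriple a b v) (C.photonHamiltonian p (fockTriple a b v))
      = ((C.hbar * C.c * ‖p‖ * (a ^ 2 + 2 * b ^ 2) : ℝ) : ℂ) := by
  have h2 : ((Real.sqrt 2 : ℝ) : ℂ) * (Real.sqrt 2 : ℝ) = 2 := by
    rw [← Complex.ofReal_mul, Real.mul_self_sqrt (by norm_num)]; norm_num
  rw [braket_fockTriple]
  simp [photonHamiltonian, creH, creV, annH, annV, fockTriple]
  norm_num
  linear_combination ((C.hbar : ℂ) * C.c * ‖p‖ * b ^ 2) * h2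

theorem braket_electronHamiltonian_fockTriple (k : E3) (a b v : ℝ) :
    braket (fockTriple a b v) (C.electronHamiltonian k (fockTriple a b v))
      = ((C.hbar * C.omega k * (2 * a ^ 2 + b ^ 2) : ℝ) : ℂ) := by
  rw [braket_fockTriple]
  simp [electronHamiltonian, applyEl_fockTriple, Fin.sum_univ_four, creEl_mul_annEl_one_one,
    creEl_mul_annEl_one_vac, creEl_mul_annEl_vac_one, creEl_mul_annEl_vac_vac, fockTriple]
  ring

theorem braket_interaction_fockTriple (P : Polarization) (p x k k' : E3) (a b v a' b' v' : ℝ) :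
    braket (fockTriple a b v) (∑ α : Fin 3, C.potential P α p x
        (applyEl (C.current α k k' x) (fockTriple a' b' v')))
      = ∑ α : Fin 3, ((C.lam / 2 * P.H p α : ℝ) : ℂ) * (wave p x + wave (-p) x)
          * (a * a' * C.current α k k' x {0} {0}) := by
  rw [braket_fockTriple]
  simp only [Finset.sum_apply, Finset.mul_sum, ← Finset.sum_add_distrib]
  refine Finset.sum_congr rfl fun α _ => ?_
  simp [potential, annH, annV, creH, creV, applyEl_fockTriple, fockTriple, current_one_vac,
    current_vac_one]
  ring

end Constants

open Classical in
/-- The occupied photon states: `|0,0⟩` and `|1,0⟩` if the electron wave vector lies in `R`, and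
`|0,2⟩` otherwise. -/
def occupation (R : Set E3) (m n : ℕ) (_p k : E3) : ℝ :=
  if k ∈ R then if (m, n) = (0, 0) ∨ (m, n) = (1, 0) then 1 else 0
  else if (m, n) = (0, 2) then 1 else 0

open Classical in
/-- The normalization `∑ τ_{m,n} / (m! n!)` of `occupation`. -/
def occupationNorm (R : Set E3) (k : E3) : ℝ := if k ∈ R then 2 else 1 / 2

open Classical in
/-- The expected photon number `∑ (m + n) τ_{m,n} / (m! n! Z)` of `occupation`. -/
def photonNumber (R : Set E3) (k : E3) : ℝ := if k ∈ R then 1 / 2 else 2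

theorem hasSum_occupation (R : Set E3) (p k : E3) :
    HasSum (fun mn : ℕ × ℕ => occupation R mn.1 mn.2 p k / (mn.1.factorial * mn.2.factorial))
      (occupationNorm R k) := by
  have h : ∑ mn ∈ ({(0, 0), (1, 0), (0, 2)} : Finset (ℕ × ℕ)),
      occupation R mn.1 mn.2 p k / (mn.1.factorial * mn.2.factorial) = occupationNorm R k := by
    by_cases hk : k ∈ R <;> simp [occupation, occupationNorm, hk]
    norm_num
  rw [← h]
  refine hasSum_sum_of_ne_finset_zero fun mn hmn => ?_
  simp only [Finset.mem_insert, Finset.mem_singleton, not_or] at hmn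
  simp [occupation, hmn.1, hmn.2.1, hmn.2.2]

theorem measurable_occupation {R : Set E3} (hR : MeasurableSet R) (m n : ℕ) :
    Measurable fun z : E3 × E3 => occupation R m n z.1 z.2 :=
  Measurable.ite (measurable_snd hR) measurable_const measurable_const

/-- The amplitude `√ρ^el` restricted to `R`. -/
def amplitude (R : Set E3) (ρel : E3 → ℝ) : E3 → ℝ := R.indicator fun k => Real.sqrt (ρel k)

/-- The trial state that belongs to `occupation` and the electron momentum region `R`. -/
def regionState (ρ ρel : E3 → ℝ) (R : Set E3) : WaveFunction :=
  trialState ρ ρel (occupation R) (occupationNorm R)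

theorem regionState_apply {ρ : E3 → ℝ} (hρ : ∀ p, 0 ≤ ρ p) (ρel : E3 → ℝ) (R : Set E3)
    (p k : E3) :
    regionState ρ ρel R p k
      = fockTriple (Real.sqrt (ρ p) * amplitude R ρel k / Real.sqrt 2)
          (Real.sqrt (ρ p) * amplitude Rᶜ ρel k) (Real.sqrt (1 - ρ p * ρel k)) := by
  ext mn S
  simp only [regionState, trialState, fockTriple, amplitude]
  by_cases hS : S = {0}
  · simp only [hS, if_true, Real.sqrt_mul (hρ p)]
    by_cases hk : k ∈ R
    · by_cases h1 : mn = (0, 0)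
      · simp [occupation, occupationNorm, hk, h1]
      by_cases h2 : mn = (1, 0)
      · simp [occupation, occupationNorm, hk, h2]
      by_cases h3 : mn = (0, 2)
      · simp [occupation, occupationNorm, hk, h3]
      · simp [occupation, hk, h1, h2, h3]
    · by_cases h1 : mn = (0, 0)
      · simp [occupation, occupationNorm, hk, h1]
      by_cases h2 : mn = (1, 0)
      · simp [occupation, occupationNorm, hk, h2]
      by_cases h3 : mn = (0, 2)
      · simp [occupation, occupationNorm, hk, h3]
      · simp [occupation, hk, h1, h2, h3]
  · simp [hS]

theorem wave_add_wave_neg (p x : E3) :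
    wave p x + wave (-p) x = ((2 * Real.cos (inner ℝ p x) : ℝ) : ℂ) := by
  rw [wave, wave, inner_neg_left]
  push_cast
  rw [Complex.cos]
  ring_nf

namespace Constants
variable (C : Constants) {ρ ρel : E3 → ℝ} {R : Set E3}

theorem photonEnergyDensity_eq (hρ : ∀ p, 0 ≤ ρ p) (hρel : ∀ k, 0 ≤ ρel k) (p k : E3) :
    C.photonEnergyDensity (regionState ρ ρel R) p k
      = ((C.hbar * C.c * (ρ p * ‖p‖) * (ρel k * photonNumber R k) : ℝ) : ℂ) := by
  rw [photonEnergyDensity, regionState_apply hρ, braket_photonHamiltonian_fockTriple]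
  congr 1
  by_cases hk : k ∈ R <;>
    simp [amplitude, photonNumber, hk, mul_pow, div_pow, Real.sq_sqrt, hρ p, hρel k] <;> ring

theorem electronEnergyDensity_eq (hρ : ∀ p, 0 ≤ ρ p) (hρel : ∀ k, 0 ≤ ρel k) (p k : E3) :
    C.electronEnergyDensity (regionState ρ ρel R) p k
      = ((C.hbar * C.omega k * ρel k * ρ p : ℝ) : ℂ) := by
  rw [electronEnergyDensity, regionState_apply hρ, braket_electronHamiltonian_fockTriple]
  congr 1
  by_cases hk : k ∈ R <;>
    simp [amplitude, hk, mul_pow, div_pow, Real.sq_sqrt, hρ p, hρel k] <;> ring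

theorem interactionKernel_eq (P : Polarization) (hρ : ∀ p, 0 ≤ ρ p) (p x k k' : E3) :
    C.interactionKernel P (regionState ρ ρel R) p x k k'
      = ∑ α : Fin 3, ((C.lam / 2 * (ρ p * P.H p α) * Real.cos (inner ℝ p x) : ℝ) : ℂ)
          * ((amplitude R ρel k : ℂ) * amplitude R ρel k' * C.current α k k' x {0} {0}) := by
  rw [interactionKernel, regionState_apply hρ, regionState_apply hρ,
    braket_interaction_fockTriple, wave_add_wave_neg]
  refine Finset.sum_congr rfl fun α _ => ?_
  have h2 : ((Real.sqrt 2 : ℝ) : ℂ) * (Real.sqrt 2 : ℝ) = 2 := by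
    rw [← Complex.ofReal_mul, Real.mul_self_sqrt (by norm_num)]; norm_num
  have h3 : ((Real.sqrt (ρ p) : ℝ) : ℂ) * (Real.sqrt (ρ p) : ℝ) = ρ p := by
    rw [← Complex.ofReal_mul, Real.mul_self_sqrt (hρ p)]
  have h4 : ((Real.sqrt 2 : ℝ) : ℂ) ≠ 0 := by
    rw [Complex.ofReal_ne_zero]; positivity
  push_cast
  field_simp
  simp only [pow_two]
  rw [h2, h3]
  ring

/-- The current `packetCurrent`, which is real because `γ⁰ γ^α` is Hermitian, as a real number. -/
def realCurrent (g : E3 → ℝ) (α : Fin 3) (x : E3) : ℝ := (C.packetCurrent g α x).re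

theorem ofReal_realCurrent (g : E3 → ℝ) (α : Fin 3) (x : E3) :
    (C.realCurrent g α x : ℂ) = C.packetCurrent g α x :=
  Complex.conj_eq_iff_re.1 (C.conj_packetCurrent g α x)

theorem integrable_kernel (P : Polarization) (hρ : ∀ p, 0 ≤ ρ p)
    (hg : Integrable (amplitude R ρel)) (p x : E3) :
    Integrable fun z : E3 × E3 => C.interactionKernel P (regionState ρ ρel R) p x z.1 z.2 := by
  simp only [C.interactionKernel_eq P hρ]
  exact integrable_finsetSum _ fun α _ => (C.integral_current_eq hg α x).1.const_mul _

/-- The interaction density is the product of a photon and an electron factor, up to the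
modulation by `cos (p·x)`. -/
theorem interactionDensity_eq (P : Polarization) (hρ : ∀ p, 0 ≤ ρ p)
    (hg : Integrable (amplitude R ρel)) (p x : E3) :
    C.interactionDensity P (regionState ρ ρel R) p x
      = ((∑ α : Fin 3, C.q * C.c * C.lam / (2 * (2 * Real.pi) ^ 3)
          * (ρ p * P.H p α * C.realCurrent (amplitude R ρel) α x
            * Real.cos (inner ℝ p x)) : ℝ) : ℂ) := by
  have h1 : ∫ k : E3, ∫ k' : E3, C.interactionKernel P (regionState ρ ρel R) p x k k'
      = ∫ z : E3 × E3, C.interactionKernel P (regionState ρ ρel R) p x z.1 z.2 :=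
    (integral_prod _ (C.integrable_kernel P hρ hg p x)).symm
  rw [interactionDensity, h1]
  simp only [C.interactionKernel_eq P hρ]
  rw [integral_finsetSum _ fun α _ => (C.integral_current_eq hg α x).1.const_mul _, Finset.mul_sum,
    Complex.ofReal_sum]
  refine Finset.sum_congr rfl fun α _ => ?_
  rw [integral_const_mul, (C.integral_current_eq hg α x).2, ← ofReal_realCurrent]
  push_cast
  ring

end Constants
theorem abs_apply_le_norm (v : E3) (α : Fin 3) : |v α| ≤ ‖v‖ := by
  simpa using PiLp.norm_apply_le v α

theorem measurable_apply (α : Fin 3) : Measurable fun v : E3 => v α :=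
  (PiLp.continuous_apply 2 _ α).measurable

namespace Polarization
variable (P : Polarization)

theorem abs_H_le_one {p : E3} (hp : p ≠ 0) (α : Fin 3) : |P.H p α| ≤ 1 :=
  (abs_apply_le_norm _ _).trans (P.norm_H p hp).le

theorem integrable_mul_H {ρ : E3 → ℝ} (hρ : Integrable ρ) (α : Fin 3) :
    Integrable fun p => ρ p * P.H p α := by
  refine hρ.mul_bdd (c := 1) ((measurable_apply α).comp P.measurable_H).aestronglyMeasurable ?_
  filter_upwards [Measure.ae_ne volume (0 : E3)] with p hp
  exact P.abs_H_le_one hp α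

theorem one_le_sum_abs_H {p : E3} (hp : p ≠ 0) : 1 ≤ ∑ α, |P.H p α| := by
  have h1 : ∑ α, P.H p α ^ 2 = 1 := by
    rw [← EuclideanSpace.real_norm_sq_eq, P.norm_H p hp, one_pow]
  rw [← h1]
  refine Finset.sum_le_sum fun α _ => ?_
  rw [← sq_abs]
  nlinarith [P.abs_H_le_one hp α, abs_nonneg (P.H p α)]

end Polarization

/-! ### The energies of the trial state -/

namespace Constants
variable (C : Constants) {ρ ρel : E3 → ℝ} {R : Set E3}

theorem integrable_realCurrent {g : E3 → ℝ} (hg : Integrable g) (hg2 : MemLp g 2) (α : Fin 3) :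
    Integrable (C.realCurrent g α) :=
  (C.integrable_packetCurrent hg hg2 α).re

theorem integral_realCurrent {g : E3 → ℝ} (hg : Integrable g) (hg2 : MemLp g 2) (α : Fin 3) :
    ∫ x, C.realCurrent g α x
      = (2 * Real.pi) ^ 3 * ∫ k, g k ^ 2 * (C.nu * C.c * k α / C.omega k) := by
  have h := C.integral_packetCurrent hg hg2 α
  simp only [← ofReal_realCurrent] at h
  rw [integral_complex_ofReal] at h
  exact_mod_cast h

theorem realCurrent_const_mul (g : E3 → ℝ) (a : ℝ) (α : Fin 3) (x : E3) :
    C.realCurrent (fun k => a * g k) α x = a ^ 2 * C.realCurrent g α x := by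
  have h : ∀ s, C.modeIntegral (fun k => a * g k) s x
      = fun r => (a : ℂ) * C.modeIntegral g s x r := fun s => by
    ext r
    simp only [modeIntegral, Complex.ofReal_mul, mul_assoc]
    exact integral_const_mul _ _
  rw [← Complex.ofReal_inj, Complex.ofReal_mul, ofReal_realCurrent, ofReal_realCurrent]
  simp only [packetCurrent, h, currentForm_smul_smul]
  push_cast
  ring

/-- The cosine transform of the current of the wave packet `g`. -/
def currentTransform (g : E3 → ℝ) (α : Fin 3) (p : E3) : ℝ :=
  ∫ x : E3, C.realCurrent g α x * Real.cos (inner ℝ p x)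

theorem integrable_realCurrent_mul_cos {g : E3 → ℝ} (hg : Integrable g) (hg2 : MemLp g 2)
    (α : Fin 3) (p : E3) :
    Integrable fun x => C.realCurrent g α x * Real.cos (inner ℝ p x) :=
  (C.integrable_realCurrent hg hg2 α).mul_bdd (c := 1)
    (Continuous.aestronglyMeasurable (by fun_prop)) (.of_forall fun x => Real.abs_cos_le_one _)

theorem continuous_currentTransform {g : E3 → ℝ} (hg : Integrable g) (hg2 : MemLp g 2)
    (α : Fin 3) : Continuous (C.currentTransform g α) := by
  refine continuous_of_dominated (bound := fun x => ‖C.realCurrent g α x‖)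
    (fun p => (C.integrable_realCurrent_mul_cos hg hg2 α p).1) (fun p => .of_forall fun x => ?_)
    (C.integrable_realCurrent hg hg2 α).norm (.of_forall fun x => by fun_prop)
  rw [norm_mul]
  exact mul_le_of_le_one_right (norm_nonneg _) (Real.abs_cos_le_one _)

/-- The strength `q c λ / (2 (2π)³)` of the interaction. -/
def couplingStrength : ℝ := C.q * C.c * C.lam / (2 * (2 * Real.pi) ^ 3)

/-- The density of the total energy with respect to the photon density `ρ(p) dp`, for the electron
density `ρel` and the region `R`. -/
def energyPerPhoton (P : Polarization) (ρel : E3 → ℝ) (R : Set E3) (p : E3) : ℝ :=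
  C.hbar * C.c * ‖p‖ * (∫ k, ρel k * photonNumber R k)
    + C.couplingStrength * ∑ α, P.H p α * C.currentTransform (amplitude R ρel) α p

theorem finiteEnergy_regionState (P : Polarization) (hρ : ∀ p, 0 ≤ ρ p) (hρel : ∀ k, 0 ≤ ρel k)
    (hρi : Integrable ρ) (hρn : Integrable fun p => ρ p * ‖p‖)
    (hN : Integrable fun k => ρel k * photonNumber R k)
    (hg : Integrable (amplitude R ρel)) (hg2 : MemLp (amplitude R ρel) 2) :
    FiniteEnergy C P (regionState ρ ρel R) where
  photon := by
    simp only [C.photonEnergyDensity_eq hρ hρel, mul_assoc (C.hbar * C.c)]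
    exact ((hρn.mul_prod hN).const_mul _).ofReal
  kernel := C.integrable_kernel P hρ hg
  interaction := by
    simp only [C.interactionDensity_eq P hρ hg]
    have h : ∀ α, Integrable fun z : E3 × E3 => C.q * C.c * C.lam / (2 * (2 * Real.pi) ^ 3)
        * (ρ z.1 * P.H z.1 α * C.realCurrent (amplitude R ρel) α z.2
          * Real.cos (inner ℝ z.1 z.2)) := fun α =>
      (((P.integrable_mul_H hρi α).mul_prod (C.integrable_realCurrent hg hg2 α)).mul_bdd
        (c := 1) (Continuous.aestronglyMeasurable (by fun_prop))
        (.of_forall fun x => Real.abs_cos_le_one _)).const_mul _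
    exact (integrable_finsetSum Finset.univ fun α _ => h α).ofReal

theorem photonEnergy_regionState (hρ : ∀ p, 0 ≤ ρ p) (hρel : ∀ k, 0 ≤ ρel k) :
    C.photonEnergy (regionState ρ ρel R)
      = ((C.ell ^ 6 * ∫ p, ρ p * (C.hbar * C.c * ‖p‖ * ∫ k, ρel k * photonNumber R k) : ℝ) : ℂ) := by
  simp only [photonEnergy, C.photonEnergyDensity_eq hρ hρel]
  rw [Complex.ofReal_mul, ← integral_complex_ofReal]
  congr 2
  ext p
  rw [integral_complex_ofReal, integral_const_mul]
  congr 1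
  ring

theorem interactionEnergy_regionState (P : Polarization) (hρ : ∀ p, 0 ≤ ρ p)
    (hg : Integrable (amplitude R ρel)) (hg2 : MemLp (amplitude R ρel) 2) :
    C.interactionEnergy P (regionState ρ ρel R)
      = ((C.ell ^ 6 * ∫ p, ρ p * (C.couplingStrength *
          ∑ α, P.H p α * C.currentTransform (amplitude R ρel) α p) : ℝ) : ℂ) := by
  simp only [interactionEnergy, C.interactionDensity_eq P hρ hg]
  rw [Complex.ofReal_mul, ← integral_complex_ofReal]
  congr 2
  ext p
  have hi := fun α => C.integrable_realCurrent_mul_cos hg hg2 α p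
  simp only [mul_assoc (ρ p * P.H p _)]
  rw [integral_complex_ofReal, integral_finsetSum _ fun α _ =>
    ((hi α).const_mul _).const_mul _]
  congr 1
  simp only [Finset.mul_sum]
  refine Finset.sum_congr rfl fun α _ => ?_
  rw [integral_const_mul, integral_const_mul, currentTransform, couplingStrength]
  ring

theorem integrable_mul_interaction (P : Polarization) (hρi : Integrable ρ)
    (hg : Integrable (amplitude R ρel)) (hg2 : MemLp (amplitude R ρel) 2) :
    Integrable fun p => ρ p * (C.couplingStrength *
      ∑ α, P.H p α * C.currentTransform (amplitude R ρel) α p) := by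
  have h : ∀ α, Integrable fun p =>
      C.couplingStrength * (ρ p * P.H p α * C.currentTransform (amplitude R ρel) α p) := by
    intro α
    refine Integrable.const_mul ((P.integrable_mul_H hρi α).mul_bdd
      (c := ∫ x, ‖C.realCurrent (amplitude R ρel) α x‖)
      (C.continuous_currentTransform hg hg2 α).aestronglyMeasurable (.of_forall fun p => ?_)) _
    refine norm_integral_le_of_norm_le (C.integrable_realCurrent hg hg2 α).norm
      (.of_forall fun x => ?_)
    rw [norm_mul]
    exact mul_le_of_le_one_right (norm_nonneg _) (Real.abs_cos_le_one _)
  refine (integrable_finsetSum Finset.univ fun α _ => h α).congr (.of_forall fun p => ?_)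
  simp only [Finset.mul_sum]
  exact Finset.sum_congr rfl fun α _ => by ring

theorem energy_regionState (P : Polarization) (hρ : ∀ p, 0 ≤ ρ p) (hρel : ∀ k, 0 ≤ ρel k)
    (hρi : Integrable ρ) (hρn : Integrable fun p => ρ p * ‖p‖)
    (hg : Integrable (amplitude R ρel)) (hg2 : MemLp (amplitude R ρel) 2) :
    Integrable (fun p => ρ p * C.energyPerPhoton P ρel R p) ∧
    C.photonEnergy (regionState ρ ρel R) + C.interactionEnergy P (regionState ρ ρel R)
      = ((C.ell ^ 6 * ∫ p, ρ p * C.energyPerPhoton P ρel R p : ℝ) : ℂ) := by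
  have h1 : Integrable fun p => ρ p * (C.hbar * C.c * ‖p‖ * ∫ k, ρel k * photonNumber R k) :=
    (hρn.mul_const (C.hbar * C.c * ∫ k, ρel k * photonNumber R k)).congr
      (.of_forall fun p => by ring)
  have h2 := C.integrable_mul_interaction P hρi hg hg2
  simp only [energyPerPhoton, mul_add (ρ _)]
  refine ⟨h1.add h2, ?_⟩
  rw [integral_add h1 h2, C.photonEnergy_regionState hρ hρel,
    C.interactionEnergy_regionState P hρ hg hg2]
  push_cast
  ring

end Constants
/-! ### The Gaussian electron density and the octants -/

theorem gaussianDensity_eq (r σ : ℝ) (k : E3) :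
    gaussianDensity r σ k = r * gaussianDensity 1 σ k := by
  simp [gaussianDensity]

theorem gaussianDensity_pos {r : ℝ} (hr : 0 < r) (σ : ℝ) (k : E3) :
    0 < gaussianDensity r σ k := mul_pos hr (Real.exp_pos _)

theorem gaussianDensity_le {r : ℝ} (hr : 0 ≤ r) (σ : ℝ) (k : E3) :
    gaussianDensity r σ k ≤ r := by
  refine mul_le_of_le_one_right hr (Real.exp_le_one_iff.2 ?_)
  rw [neg_div]
  exact neg_nonpos.2 (by positivity)

theorem integrable_gaussianDensity (r : ℝ) {σ : ℝ} (hσ : 0 < σ) :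
    Integrable (gaussianDensity r σ) := by
  have h := (GaussianFourier.integrable_cexp_neg_mul_sq_norm_add (V := E3)
    (b := ((2 * σ ^ 2)⁻¹ : ℝ)) (by rw [Complex.ofReal_re]; positivity) 0 0).norm
  refine (h.const_mul r).congr (.of_forall fun k => ?_)
  simp only [gaussianDensity, Complex.norm_exp]
  congr 2
  rw [zero_mul, add_zero, ← Complex.ofReal_neg, ← Complex.ofReal_pow, ← Complex.ofReal_mul,
    Complex.ofReal_re]
  ring

theorem sqrt_gaussianDensity {r : ℝ} (hr : 0 ≤ r) {σ : ℝ} (k : E3) :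
    Real.sqrt (gaussianDensity r σ k) = gaussianDensity (Real.sqrt r) (Real.sqrt 2 * σ) k := by
  rw [gaussianDensity, Real.sqrt_mul hr, ← Real.exp_half, gaussianDensity, mul_pow,
    Real.sq_sqrt (by norm_num)]
  congr 2
  ring

section
variable {R : Set E3} {σ : ℝ}

theorem integrable_amplitude (hR : MeasurableSet R) {r : ℝ} (hr : 0 ≤ r) (hσ : 0 < σ) :
    Integrable (amplitude R (gaussianDensity r σ)) := by
  refine Integrable.indicator ?_ hR
  simp only [sqrt_gaussianDensity hr]
  exact integrable_gaussianDensity _ (by positivity)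

theorem amplitude_sq {ρel : E3 → ℝ} (hρel : ∀ k, 0 ≤ ρel k) (k : E3) :
    amplitude R ρel k ^ 2 = R.indicator ρel k := by
  by_cases hk : k ∈ R <;> simp [amplitude, hk, Real.sq_sqrt, hρel k]

theorem memLp_amplitude (hR : MeasurableSet R) {r : ℝ} (hr : 0 < r) (hσ : 0 < σ) :
    MemLp (amplitude R (gaussianDensity r σ)) 2 := by
  rw [memLp_two_iff_integrable_sq (integrable_amplitude hR hr.le hσ).1]
  simp only [amplitude_sq fun k => (gaussianDensity_pos hr σ k).le]
  exact (integrable_gaussianDensity r hσ).indicator hR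

theorem amplitude_gaussianDensity {r : ℝ} (hr : 0 ≤ r) :
    amplitude R (gaussianDensity r σ)
      = fun k => Real.sqrt r * amplitude R (gaussianDensity 1 σ) k := by
  ext k
  by_cases hk : k ∈ R
  · simp only [amplitude, Set.indicator_of_mem hk]
    rw [gaussianDensity_eq, Real.sqrt_mul hr]
  · simp [amplitude, hk]

theorem integrable_mul_photonNumber (hR : MeasurableSet R) {ρel : E3 → ℝ}
    (h : Integrable ρel) : Integrable fun k => ρel k * photonNumber R k := by
  refine h.mul_bdd (c := 2)
    (Measurable.ite hR measurable_const measurable_const).aestronglyMeasurable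
    (.of_forall fun k => ?_)
  by_cases hk : k ∈ R <;> simp [photonNumber, hk]
  norm_num

end

/-- Every contribution to the energy is proportional to the electron density at the origin. -/
theorem Constants.energyPerPhoton_gaussianDensity (C : Constants) (P : Polarization) {r : ℝ}
    (hr : 0 ≤ r) (σ : ℝ) (R : Set E3) (p : E3) :
    C.energyPerPhoton P (gaussianDensity r σ) R p
      = r * C.energyPerPhoton P (gaussianDensity 1 σ) R p := by
  have h1 : ∫ k, gaussianDensity r σ k * photonNumber R k
      = r * ∫ k, gaussianDensity 1 σ k * photonNumber R k := by
    rw [← integral_const_mul]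
    refine integral_congr_ae (.of_forall fun k => ?_)
    simp only [gaussianDensity_eq r σ k, mul_assoc]
  have h2 : ∀ α, C.currentTransform (amplitude R (gaussianDensity r σ)) α p
      = r * C.currentTransform (amplitude R (gaussianDensity 1 σ)) α p := fun α => by
    rw [amplitude_gaussianDensity hr, currentTransform, currentTransform, ← integral_const_mul]
    simp only [realCurrent_const_mul, Real.sq_sqrt hr, mul_assoc]
  simp only [energyPerPhoton, h1, h2, mul_add, Finset.mul_sum]
  congr 1
  · ring
  · exact Finset.sum_congr rfl fun α _ => by ring

/-- The open octant of the wave vectors `k` for which the sign of `k_α` is opposite to `s α`. -/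
def octant (s : Fin 3 → ℝ) : Set E3 := {k | ∀ α, s α * k α < 0}

theorem isOpen_octant (s : Fin 3 → ℝ) : IsOpen (octant s) := by
  simp only [octant, Set.ofPred_forall]
  exact isOpen_iInter_of_finite fun α => isOpen_lt
    (continuous_const.mul (PiLp.continuous_apply 2 _ α)) continuous_const

/-- The integral of `ν` times the velocity in units of the speed of light, over the electrons with
wave vector in `R`, for the Gaussian density with value `1` at the origin. -/
def Constants.meanVelocity (C : Constants) (σ : ℝ) (R : Set E3) (α : Fin 3) : ℝ :=
  ∫ k, amplitude R (gaussianDensity 1 σ) k ^ 2 * (C.nu * C.c * k α / C.omega k)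

namespace Constants
variable (C : Constants) {σ : ℝ}

theorem currentTransform_zero {R : Set E3} (hR : MeasurableSet R) (hσ : 0 < σ) (α : Fin 3) :
    C.currentTransform (amplitude R (gaussianDensity 1 σ)) α 0
      = (2 * Real.pi) ^ 3 * C.meanVelocity σ R α := by
  simp only [currentTransform, inner_zero_left, Real.cos_zero, mul_one]
  exact C.integral_realCurrent (integrable_amplitude hR zero_le_one hσ)
    (memLp_amplitude hR one_pos hσ) α

theorem mul_meanVelocity_octant_neg (hσ : 0 < σ) {s : Fin 3 → ℝ} (hs : ∀ α, s α ≠ 0)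
    (α : Fin 3) : s α * C.meanVelocity σ (octant s) α < 0 := by
  have hν := C.nu_pos
  have hc := C.c_pos
  have hsq := amplitude_sq (R := octant s) (ρel := gaussianDensity 1 σ)
    fun k => (gaussianDensity_pos one_pos σ k).le
  have hm := (isOpen_octant s).measurableSet
  have hvel : ∀ k : E3, ‖C.nu * C.c * k α / C.omega k‖ ≤ C.nu := fun k => by
    have hω := C.omega_pos k
    rw [norm_div, Real.norm_of_nonneg hω.le, div_le_iff₀ hω, norm_mul,
      Real.norm_of_nonneg (by positivity), Real.norm_eq_abs, mul_assoc]
    refine mul_le_mul_of_nonneg_left ?_ hν.le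
    exact (mul_le_mul_of_nonneg_left (abs_apply_le_norm k α) hc.le).trans (C.c_mul_norm_le_omega k)
  have hvelm : Measurable fun k : E3 => C.nu * C.c * k α / C.omega k :=
    ((measurable_apply α).const_mul _).div C.continuous_omega.measurable
  set f : E3 → ℝ := fun k => -s α * ((octant s).indicator (gaussianDensity 1 σ) k
    * (C.nu * C.c * k α / C.omega k)) with hf
  have hpos : ∀ k ∈ octant s, 0 < f k := fun k hk => by
    have hω := C.omega_pos k
    have hG := gaussianDensity_pos one_pos σ k
    have h : f k = gaussianDensity 1 σ k * (C.nu * C.c / C.omega k) * -(s α * k α) := by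
      simp only [hf, Set.indicator_of_mem hk]; ring
    rw [h]
    exact mul_pos (by positivity) (neg_pos.2 (hk α))
  have hzero : ∀ k ∉ octant s, f k = 0 := fun k hk => by simp [hf, hk]
  have hint : Integrable f :=
    ((((integrable_gaussianDensity 1 hσ).indicator hm).mul_bdd (c := C.nu)
      hvelm.aestronglyMeasurable (.of_forall hvel))).const_mul _
  have hne : (octant s).Nonempty := by
    refine ⟨WithLp.toLp 2 fun β => -s β, fun β => ?_⟩
    have := mul_self_pos.2 (hs β)
    simpa using this
  have h : 0 < ∫ k, f k := by
    rw [integral_pos_iff_support_of_nonneg_ae (.of_forall fun k => ?_) hint]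
    · exact ((isOpen_octant s).measure_pos volume hne).trans_le
        (measure_mono fun k hk => (hpos k hk).ne')
    · by_cases hk : k ∈ octant s
      · exact (hpos k hk).le
      · exact (hzero k hk).ge
  simp only [hf] at h
  rw [integral_const_mul] at h
  simp only [meanVelocity, hsq]
  linarith

/-- If the components of `q λ ε^(H)(p)` have the signs `s`, then the electrons in the octant of `s`
move against `q λ ε^(H)(p)`. For small `p` the gain in interaction energy, which is almost
independent of `p`, exceeds the photon energy `ħ c |p|`. -/
theorem exists_radius_energyPerPhoton_neg (P : Polarization) (hσ : 0 < σ) {s : Fin 3 → ℝ}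
    (hs : ∀ α, s α ≠ 0) :
    ∃ d > 0, ∀ p : E3, p ≠ 0 → ‖p‖ < d → (∀ α, 0 ≤ s α * (C.q * C.lam * P.H p α)) →
      C.energyPerPhoton P (gaussianDensity 1 σ) (octant s) p < 0 := by
  set g := amplitude (octant s) (gaussianDensity 1 σ) with hg
  set D := C.meanVelocity σ (octant s) with hD
  have hm := (isOpen_octant s).measurableSet
  have hc := C.c_pos
  have hqc : 0 < |C.q * C.lam| := abs_pos.2 (mul_ne_zero C.q_ne C.lam_ne)
  have hDneg := fun α => C.mul_meanVelocity_octant_neg hσ hs α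
  have hDpos : ∀ α, 0 < |D α| := fun α => abs_pos.2 fun h => by
    have := hDneg α
    rw [← hD, h, mul_zero] at this
    exact lt_irrefl _ this
  obtain ⟨m, hm0, hmD⟩ : ∃ m > 0, ∀ α, m ≤ |D α| := by
    obtain ⟨β, hβ⟩ := Finite.exists_min fun α => |D α|
    exact ⟨_, hDpos β, hβ⟩
  set f : E3 → ℝ := fun p =>
    C.hbar * C.c * ‖p‖ * (∫ k, gaussianDensity 1 σ k * photonNumber (octant s) k)
      + |C.couplingStrength| * ∑ α, |C.currentTransform g α p - C.currentTransform g α 0| with hf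
  have hfc : Continuous f := by
    have := fun α => C.continuous_currentTransform (integrable_amplitude hm zero_le_one hσ)
      (memLp_amplitude hm one_pos hσ) α
    fun_prop
  have hf0 : f 0 < C.c / 2 * (|C.q * C.lam| * m) := by
    simp only [hf, norm_zero, mul_zero, zero_mul, sub_self, abs_zero, Finset.sum_const_zero,
      add_zero]
    positivity
  obtain ⟨d, hd, hball⟩ := Metric.mem_nhds_iff.1
    ((isOpen_lt hfc continuous_const).mem_nhds hf0)
  refine ⟨d, hd, fun p hp hpd hsign => ?_⟩
  have hfp : f p < C.c / 2 * (|C.q * C.lam| * m) := hball (by simpa using hpd)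
  have hterm : ∀ α, C.q * C.lam * P.H p α * D α ≤ -(|C.q * C.lam| * m * |P.H p α|) := by
    intro α
    -- `q λ ε_α` has the sign of `s α`, and the mean velocity has the opposite sign
    have h1 : C.q * C.lam * P.H p α * D α ≤ 0 := by
      have h2 : 0 ≤ (s α * (C.q * C.lam * P.H p α)) * -(s α * D α) :=
        mul_nonneg (hsign α) (neg_nonneg.2 (hDneg α).le)
      have h3 : 0 < s α ^ 2 := by have := hs α; positivity
      nlinarith
    rw [← neg_neg (C.q * C.lam * P.H p α * D α), ← abs_of_nonpos h1, abs_mul, abs_mul]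
    refine neg_le_neg ?_
    rw [mul_right_comm]
    exact mul_le_mul_of_nonneg_left (hmD α) (by positivity)
  have hmain : C.couplingStrength * ∑ α, P.H p α * C.currentTransform g α 0
      ≤ -(C.c / 2 * (|C.q * C.lam| * m)) := by
    have h1 : C.couplingStrength * ∑ α, P.H p α * C.currentTransform g α 0
        = C.c / 2 * ∑ α, C.q * C.lam * P.H p α * D α := by
      simp only [hg, C.currentTransform_zero hm hσ, Finset.mul_sum, couplingStrength]
      refine Finset.sum_congr rfl fun α _ => ?_
      have := Real.pi_pos
      field_simp
      rfl
    rw [h1, ← mul_neg]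
    refine mul_le_mul_of_nonneg_left ?_ (by positivity)
    refine (Finset.sum_le_sum fun α _ => hterm α).trans ?_
    rw [Finset.sum_neg_distrib, ← Finset.mul_sum]
    exact neg_le_neg (le_mul_of_one_le_right (by positivity) (P.one_le_sum_abs_H hp))
  have hdiff : C.couplingStrength * ∑ α, P.H p α * C.currentTransform g α p
      ≤ C.couplingStrength * ∑ α, P.H p α * C.currentTransform g α 0
        + |C.couplingStrength| * ∑ α, |C.currentTransform g α p - C.currentTransform g α 0| := by
    rw [← sub_le_iff_le_add', ← mul_sub, ← Finset.sum_sub_distrib]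
    refine (le_abs_self _).trans ?_
    rw [abs_mul]
    refine mul_le_mul_of_nonneg_left ((Finset.abs_sum_le_sum_abs _ _).trans
      (Finset.sum_le_sum fun α _ => ?_)) (abs_nonneg _)
    rw [← mul_sub, abs_mul]
    exact mul_le_of_le_one_left (abs_nonneg _) (P.abs_H_le_one hp α)
  simp only [energyPerPhoton, ← hg]
  simp only [hf] at hfp
  linarith

end Constants
/-! ### Choice of the photon momentum density -/

/-- The sign `1` or `-1` that belongs to a truth value. -/
def boolSign (b : Bool) : ℝ := if b then 1 else -1

theorem boolSign_ne_zero (b : Bool) : boolSign b ≠ 0 := by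
  cases b <;> simp [boolSign]

/-- The wave vectors `p ≠ 0` of length less than `d` for which the sign pattern of the components
of `q λ ε^(H)(p)` is `b`. -/
def signCell (C : Constants) (P : Polarization) (d : ℝ) (b : Fin 3 → Bool) : Set E3 :=
  (Metric.ball 0 d \ {0}) ∩ {p | ∀ α, 0 ≤ C.q * C.lam * P.H p α ↔ b α = true}

theorem measurableSet_signCell (C : Constants) (P : Polarization) (d : ℝ) (b : Fin 3 → Bool) :
    MeasurableSet (signCell C P d b) := by
  refine (measurableSet_ball.diff (measurableSet_singleton 0)).inter ?_
  simp only [Set.ofPred_forall]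
  refine MeasurableSet.iInter fun α => ?_
  have h : MeasurableSet {p | 0 ≤ C.q * C.lam * P.H p α} :=
    measurableSet_le measurable_const
      (((measurable_apply α).comp P.measurable_H).const_mul _)
  cases b α
  · convert h.compl using 1
    ext p
    simp
  · simpa using h

theorem exists_signCell_measure_pos (C : Constants) (P : Polarization) {d : ℝ} (hd : 0 < d) :
    ∃ b, 0 < volume (signCell C P d b) := by
  by_contra! h
  have h0 : volume (⋃ b, signCell C P d b) = 0 :=
    measure_iUnion_null fun b => le_antisymm (h b) bot_le
  have hsub : Metric.ball (0 : E3) d \ {0} ⊆ ⋃ b, signCell C P d b := fun p hp =>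
    Set.mem_iUnion.2 ⟨fun α => decide (0 ≤ C.q * C.lam * P.H p α), hp, fun α => by simp⟩
  have h1 : volume (Metric.ball (0 : E3) d \ {0}) = 0 := measure_mono_null hsub h0
  rw [measure_sdiff_null (measure_singleton 0)] at h1
  exact (Metric.measure_ball_pos volume (0 : E3) hd).ne' h1

/-- There are a sign pattern and a set of positive measure of small photon wave vectors such that
each of these photons has negative total energy in the field of the electrons in an octant. -/
theorem exists_set_energyPerPhoton_neg (C : Constants) (P : Polarization) {σ δ : ℝ} (hσ : 0 < σ)
    (hδ : 0 < δ) :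
    ∃ (s : Fin 3 → ℝ) (B : Set E3), MeasurableSet B ∧ 0 < volume B ∧ B ⊆ Metric.ball 0 δ ∧
      ∀ p ∈ B, C.energyPerPhoton P (gaussianDensity 1 σ) (octant s) p < 0 := by
  choose d hd hneg using fun b : Fin 3 → Bool =>
    C.exists_radius_energyPerPhoton_neg P hσ fun α => boolSign_ne_zero (b α)
  obtain ⟨β, hβ⟩ := Finite.exists_min d
  obtain ⟨b, hb⟩ := exists_signCell_measure_pos C P (lt_min (hd β) hδ)
  refine ⟨_, _, measurableSet_signCell C P _ b, hb, fun p hp => ?_, fun p hp =>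
    hneg b p hp.1.2 ?_ fun α => ?_⟩
  · exact Metric.ball_subset_ball (min_le_right _ _) hp.1.1
  · exact (mem_ball_zero_iff.1 hp.1.1).trans_le ((min_le_left _ _).trans (hβ b))
  · have h := hp.2 α
    cases hbα : b α
    · have : ¬ 0 ≤ C.q * C.lam * P.H p α := fun h' => by simpa [hbα] using h.1 h'
      simp only [boolSign]
      norm_num
      linarith
    · simpa [boolSign] using h.2 hbα

end RQED

end

open RQED in
theorem mainTheorem1 (C : RQED.Constants) (P : RQED.Polarization) (σ : ℝ) (hσ : 0 < σ)
    (δ : ℝ) (hδ : 0 < δ) :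
    ∃ r₀ : ℝ, 0 < r₀ ∧ ∀ r : ℝ, 0 < r → r ≤ r₀ →
      ∃ (ρ : E3 → ℝ) (τ : ℕ → ℕ → E3 → E3 → ℝ) (Z : E3 → ℝ) (ψ : WaveFunction),
        IsTrialData C ρ (gaussianDensity r σ) τ Z ∧
        (∀ p, δ < ‖p‖ → ρ p = 0) ∧
        ψ = trialState ρ (gaussianDensity r σ) τ Z ∧
        FiniteEnergy C P ψ ∧
        (∃ E : ℝ, E < 0 ∧ C.photonEnergy ψ + C.interactionEnergy P ψ = (E : ℂ)) ∧
        ∀ k : E3, MeasureTheory.Integrable (fun p => C.electronEnergyDensity ψ p k) ∧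
          ((C.ell ^ 3 : ℝ) : ℂ) * ∫ p : E3, C.electronEnergyDensity ψ p k
            = ((gaussianDensity r σ k * (C.hbar * C.omega k) : ℝ) : ℂ) := by
  obtain ⟨s, B, hB, hB0, hBδ, hneg⟩ := exists_set_energyPerPhoton_neg C P hσ hδ
  have hell := C.ell_pos
  have hBfin : volume B ≠ ⊤ := ((measure_mono hBδ).trans_lt measure_ball_lt_top).ne
  have hv : 0 < volume.real B := ENNReal.toReal_pos hB0.ne' hBfin
  -- `ρ` is uniformly distributed on `B`, with value `a`, so that `ρ ρ^el ≤ 1` iff `r ≤ 1 / a`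
  set a : ℝ := (C.ell ^ 3 * volume.real B)⁻¹ with ha
  have ha0 : 0 < a := by positivity
  refine ⟨a⁻¹, by positivity, fun r hr hra => ?_⟩
  set ρ : E3 → ℝ := B.indicator fun _ => a with hρdef
  have hρ : ∀ p, 0 ≤ ρ p := Set.indicator_nonneg fun _ _ => ha0.le
  have hρle : ∀ p, ρ p ≤ a := Set.indicator_le' (fun _ _ => le_rfl) fun _ _ => ha0.le
  have hρ0 : ∀ p ∉ B, ρ p = 0 := fun p hp => Set.indicator_of_notMem hp _
  have hρi : MeasureTheory.Integrable ρ :=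
    (MeasureTheory.integrable_indicator_iff hB).2 (MeasureTheory.integrableOn_const hBfin)
  have hρint : C.ell ^ 3 * ∫ p, ρ p = 1 := by
    rw [MeasureTheory.integral_indicator_const _ hB, smul_eq_mul, ha]
    field_simp
  have hBnorm : ∀ p ∈ B, ‖p‖ < δ := fun p hp => mem_ball_zero_iff.1 (hBδ hp)
  have hρn : MeasureTheory.Integrable fun p => ρ p * ‖p‖ := by
    refine (hρi.mul_const δ).mono'
      (hρi.1.mul continuous_norm.aestronglyMeasurable) (.of_forall fun p => ?_)
    rw [Real.norm_of_nonneg (mul_nonneg (hρ p) (norm_nonneg p))]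
    by_cases hp : p ∈ B
    · exact mul_le_mul_of_nonneg_left (hBnorm p hp).le (hρ p)
    · simp [hρ0 p hp]
  have hρel : ∀ k, 0 ≤ gaussianDensity r σ k := fun k => (gaussianDensity_pos hr σ k).le
  have hR := (isOpen_octant s).measurableSet
  have hg := integrable_amplitude hR hr.le hσ
  have hg2 := memLp_amplitude hR hr hσ
  obtain ⟨hEi, hE⟩ := C.energy_regionState P hρ hρel hρi hρn hg hg2
  refine ⟨ρ, occupation (octant s), occupationNorm (octant s),
    regionState ρ (gaussianDensity r σ) (octant s), ?_, ?_, rfl, ?_, ⟨_, ?_, hE⟩, fun k => ?_⟩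
  · exact
      { measurable_ρ := measurable_const.indicator hB
        ρ_nonneg := hρ
        ρ_integrable := hρi
        ρ_normalized := hρint
        mul_le_one := fun p k => by
          calc ρ p * gaussianDensity r σ k ≤ a * a⁻¹ :=
                mul_le_mul (hρle p) ((gaussianDensity_le hr.le σ k).trans hra) (hρel k) ha0.le
            _ = 1 := mul_inv_cancel₀ ha0.ne'
        measurable_τ := measurable_occupation hR
        τ_zero_or_one := fun m n p k => by
          unfold occupation
          split_ifs <;> simp
        Z_pos := fun k => by
          unfold occupationNorm
          split_ifs <;> norm_num
        τ_sum := hasSum_occupation _ }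
  · exact fun p hp => hρ0 p fun hpB => (hBnorm p hpB).not_gt hp
  · exact C.finiteEnergy_regionState P hρ hρel hρi hρn
      (integrable_mul_photonNumber hR (integrable_gaussianDensity r hσ)) hg hg2
  · refine mul_neg_of_pos_of_neg (by positivity) ?_
    have hB1 : ∀ p ∈ B, ρ p * C.energyPerPhoton P (gaussianDensity r σ) (octant s) p < 0 := by
      intro p hp
      rw [C.energyPerPhoton_gaussianDensity P hr.le, hρdef, Set.indicator_of_mem hp]
      exact mul_neg_of_pos_of_neg ha0 (mul_neg_of_pos_of_neg hr (hneg p hp))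
    have hEn : MeasureTheory.Integrable fun p =>
        -(ρ p * C.energyPerPhoton P (gaussianDensity r σ) (octant s) p) := hEi.neg
    have hpos : 0 < ∫ p, -(ρ p * C.energyPerPhoton P (gaussianDensity r σ) (octant s) p) := by
      rw [MeasureTheory.integral_pos_iff_support_of_nonneg_ae (.of_forall fun p => ?_) hEn]
      · exact hB0.trans_le (MeasureTheory.measure_mono fun p hp => (neg_pos.2 (hB1 p hp)).ne')
      · by_cases hp : p ∈ B
        · exact (neg_pos.2 (hB1 p hp)).le
        · simp [hρ0 p hp]
    rw [MeasureTheory.integral_neg] at hpos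
    linarith
  · simp only [C.electronEnergyDensity_eq hρ hρel]
    refine ⟨(hρi.const_mul _).ofReal, ?_⟩
    rw [integral_complex_ofReal, MeasureTheory.integral_const_mul, ← Complex.ofReal_mul]
    congr 1
    linear_combination (C.hbar * C.omega k * gaussianDensity r σ k) * hρint
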